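/- Let $E$ be a complex Banach space and let $A : D(A)\subset E\to E$ be a closed, densely defined linear operator. Write $\rho(A)$ for the set of $\lambda\in\mathbb{C}$ such that $\lambda I-A : D(A)\to E$ is bijective, and $R(\lambda;A)=(\lambda I-A)^{-1}$ for $\lambda\in\rho(A)$. Suppose that (i) there is $\delta\in\left]0,\frac{\pi}{2}\right[$ such that $$\rho(A)\supset\Sigma_\delta=\left\{\lambda\in\mathbb{C}\setminus\{0\} : |\arg\lambda|<\tfrac{\pi}{2}+\delta\right\}\cup\{0\},\qquad \arg\lambda\in\left]-\pi,\pi\right];$$ (ii) there is a constant $K>1$ such that $\|R(\lambda;A)\|\le \dfrac{K}{|\lambda|}$ for all $\lambda\in\Sigma_\delta\setminus\{0\}$. Then $A$ is the infinitesimal generator of a $C_0$-semigroup $\{T(t)\}_{t\ge 0}$ of bounded linear operators on $E$ for which there is $M>1$ with $\|T(t)\|\le M$ for all $t\ge 0$. Moreover, for every $\nu\in\left]\frac{\pi}{2},\frac{\pi}{2}+\delta\right[$, let $\Gamma_\nu=\Gamma_\nu^{(1)}\cup\Gamma_\nu^{(2)}$ with $$\Gamma_\nu^{(1)}=\{r(\cos\nu-i\sin\nu)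 : r\in[0,\infty)\},\qquad \Gamma_\nu^{(2)}=\{r(\cos\nu+i\sin\nu) : r\in[0,\infty)\},$$ oriented so that $\operatorname{Im} z$ increases along $\Gamma_\nu$. Then for every $t>0$ $$T(t)=\frac{1}{2\pi i}\int_{\Gamma_\nu} e^{zt}R(z;A)\,dz ,$$ where the integral converges absolutely in the operator norm. For every $\varepsilon>0$ the convergence is uniform with respect to $t\in[\varepsilon,\infty)$: along each of the two rays, the integral over $0\le r\le N$ converges in operator norm, as $N\to\infty$, to the integral over the whole ray, uniformly in $t\ge\varepsilon$. -/

import Mathlib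

open Filter Topology Set MeasureTheory

namespace LinearPMap

variable {E : Type*} [NormedAddCommGroup E] [NormedSpace ℂ E]

/-- The operator `z I - A`, defined on the domain of `A`. -/
def smulIdSub (A : E →ₗ.[ℂ] E) (z : ℂ) : A.domain →ₗ[ℂ] E :=
  z • A.domain.subtype - A.toFun

/-- The resolvent set `ρ(A)`: all `z` such that `z I - A : D(A) → E` is bijective. -/
def resolventSet (A : E →ₗ.[ℂ] E) : Set ℂ :=
  {z | Function.Bijective (A.smulIdSub z)}

/-- The inverse of `z I - A`, for `z ∈ ρ(A)`, as an everywhere defined linear map of `E`. -/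
noncomputable def resolventLinear (A : E →ₗ.[ℂ] E) (z : ℂ) (hz : z ∈ A.resolventSet) :
    E →ₗ[ℂ] E :=
  A.domain.subtype ∘ₗ ((LinearEquiv.ofBijective (A.smulIdSub z) hz).symm : E →ₗ[ℂ] A.domain)

open Classical in
/-- The resolvent `R(z;A) = (z I - A)⁻¹` as a bounded operator. For closed `A` on a Banach space it
is the inverse of `z I - A` at every `z ∈ ρ(A)`, see `resolvent_eq_resolventLinear` and
`smulIdSub_resolvent`; it is set to `0` off `ρ(A)`. -/
noncomputable def resolvent (A : E →ₗ.[ℂ] E) (z : ℂ) : E →L[ℂ] E :=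
  if h : ∃ hz : z ∈ A.resolventSet, Continuous (A.resolventLinear z hz) then
    ⟨A.resolventLinear z h.choose, h.choose_spec⟩
  else 0

theorem resolventLinear_mem (A : E →ₗ.[ℂ] E) (z : ℂ) (hz : z ∈ A.resolventSet) (y : E) :
    A.resolventLinear z hz y ∈ A.domain :=
  Subtype.property _

theorem smulIdSub_resolventLinear (A : E →ₗ.[ℂ] E) (z : ℂ) (hz : z ∈ A.resolventSet) (y : E) :
    A.smulIdSub z ⟨A.resolventLinear z hz y, A.resolventLinear_mem z hz y⟩ = y :=
  (LinearEquiv.ofBijective (A.smulIdSub z) hz).apply_symm_apply y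

theorem continuous_resolventLinear [CompleteSpace E] {A : E →ₗ.[ℂ] E} (hA : A.IsClosed) (z : ℂ)
    (hz : z ∈ A.resolventSet) : Continuous (A.resolventLinear z hz) := by
  apply LinearMap.continuous_of_isClosed_graph
  have h : ((A.resolventLinear z hz).graph : Set (E × E)) =
      (fun p : E × E => (p.2, z • p.2 - p.1)) ⁻¹' (A.graph : Set (E × E)) := by
    ext ⟨y, x⟩
    simp only [SetLike.mem_coe, LinearMap.mem_graph_iff, Set.mem_preimage, LinearPMap.mem_graph_iff]
    constructor
    · rintro rfl
      refine ⟨⟨_, A.resolventLinear_mem z hz y⟩, rfl, ?_⟩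
      have h := A.smulIdSub_resolventLinear z hz y
      simp only [smulIdSub, LinearMap.sub_apply, LinearMap.smul_apply, Submodule.subtype_apply,
        LinearPMap.toFun_eq_coe] at h
      exact (sub_eq_iff_eq_add.mp h).symm ▸ (by simp)
    · rintro ⟨x', rfl, hx⟩
      have h : A.smulIdSub z x' = y := by
        simp [smulIdSub, LinearPMap.toFun_eq_coe, hx]
      have h2 := hz.1 (h.trans (A.smulIdSub_resolventLinear z hz y).symm)
      exact congrArg Subtype.val h2
  rw [h]
  exact IsClosed.preimage (by fun_prop) hA

theorem resolvent_eq_resolventLinear [CompleteSpace E] {A : E →ₗ.[ℂ] E} (hA : A.IsClosed) (z : ℂ)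
    (hz : z ∈ A.resolventSet) (y : E) : A.resolvent z y = A.resolventLinear z hz y := by
  have h : ∃ hz : z ∈ A.resolventSet, Continuous (A.resolventLinear z hz) :=
    ⟨hz, continuous_resolventLinear hA z hz⟩
  rw [resolvent, dif_pos h]
  rfl

theorem smulIdSub_resolvent [CompleteSpace E] {A : E →ₗ.[ℂ] E} (hA : A.IsClosed) (z : ℂ)
    (hz : z ∈ A.resolventSet) (y : E) :
    ∃ x : A.domain, (x : E) = A.resolvent z y ∧ z • (x : E) - A x = y :=
  ⟨⟨_, A.resolventLinear_mem z hz y⟩, (resolvent_eq_resolventLinear hA z hz y).symm,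
    A.smulIdSub_resolventLinear z hz y⟩

/-- `z = r (cos θ + i sin θ)`, the point at distance `r` on the ray of direction `θ`. -/
noncomputable def rayPoint (θ r : ℝ) : ℂ :=
  (r : ℂ) * ((Real.cos θ : ℂ) + (Real.sin θ : ℂ) * Complex.I)

/-- `e^{zt} R(z;A) dz/dr` at `z = rayPoint θ r`, the integrand of `∫ e^{zt} R(z;A) dz` along the ray
of direction `θ` run through from `0` to `∞`. -/
noncomputable def rayIntegrand (A : E →ₗ.[ℂ] E) (θ t r : ℝ) : E →L[ℂ] E :=
  (Complex.exp (rayPoint θ r * (t : ℂ)) *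
    ((Real.cos θ : ℂ) + (Real.sin θ : ℂ) * Complex.I)) • A.resolvent (rayPoint θ r)

/-- `∫_{Γ_ν} e^{zt} R(z;A) dz`, where `Γ_ν` comes from infinity to `0` along the ray of direction
`-ν` and goes back to infinity along the ray of direction `ν`. -/
noncomputable def sectorContourIntegral (A : E →ₗ.[ℂ] E) (ν t : ℝ) : E →L[ℂ] E :=
  (∫ r in Ioi (0 : ℝ), A.rayIntegrand ν t r) - ∫ r in Ioi (0 : ℝ), A.rayIntegrand (-ν) t r

end LinearPMap

/-- `{T(t)}_{t ≥ 0}` is a `C₀`-semigroup of bounded operators (values at `t < 0` are irrelevant). -/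
structure IsC0Semigroup {E : Type*} [NormedAddCommGroup E] [NormedSpace ℂ E]
    (T : ℝ → E →L[ℂ] E) : Prop where
  zero : T 0 = ContinuousLinearMap.id ℂ E
  add : ∀ t s : ℝ, 0 ≤ t → 0 ≤ s → T (t + s) = (T t).comp (T s)
  tendsto_zero : ∀ x : E, Tendsto (fun t : ℝ => T t x) (𝓝[>] 0) (𝓝 x)

/-- `A` is the infinitesimal generator of `T`: `x ∈ D(A)` and `A x = y` if and only if
`(T(t) x - x) / t → y` as `t ↓ 0`. -/
def IsInfinitesimalGenerator {E : Type*} [NormedAddCommGroup E] [NormedSpace ℂ E]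
    (A : E →ₗ.[ℂ] E) (T : ℝ → E →L[ℂ] E) : Prop :=
  ∀ x y : E, (x, y) ∈ A.graph ↔
    Tendsto (fun t : ℝ => ((t⁻¹ : ℝ) : ℂ) • (T t x - x)) (𝓝[>] 0) (𝓝 y)

/-- The sector `Σ_δ = {z : |arg z| < π/2 + δ} ∪ {0}`. -/
def sectorSet (δ : ℝ) : Set ℂ :=
  {z : ℂ | z ≠ 0 ∧ |z.arg| < Real.pi / 2 + δ} ∪ {0}

/-! Only the resolvent equation and the bound `‖z‖ * ‖R z‖ ≤ K` enter the contour work. Since 0 lies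
in the resolvent set, R(z) = R(0) - z R(z) R(0), so R stays bounded on the whole sector and the
vertex of Γ_ν is harmless. On the rays |e^{zt}| = e^{rt cos ν} with cos ν < 0, which gives absolute
convergence, uniformly for t ≥ ε. Cauchy's theorem makes the integral T(t) independent of ν and lets
the vertex be replaced by an arc of radius 1/t; there the bound K/|z| scales exactly and bounds T(t)
uniformly in t (`norm_dunfordIntegral_le`).

The rest is read off T(t)R(0), where R(0) = -A⁻¹ supplies the missing decay. Comparing with ∫
e^{zt}/z dz = 2πi gives T(t)R(0) → R(0) at rate O(t) (`norm_zero_sub_dunfordIntegral_mul_le`).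
Differentiating under the integral gives (T(t)R(0))' = -T(t) (`hasDerivAt_dunfordIntegral_mul`). The
semigroup law needs no double contour integral: τ ↦ T(t+s-τ)R(0) T(τ)R(0) has derivative zero, and
the injective R(0) cancels. Strong continuity follows from the uniform bound and the density of the
range of R(0), which is D(A).

For the generator, (x, y) is in the graph of A iff R(0)y = -x. Such an x has T(t)x = -T(t)R(0)y,
with derivative T(t)y → y. Conversely, applying R(0) to a convergent difference quotient forces
R(0)y = -x. -/

/-! ### Cauchy's theorem in polar coordinates. -/

section PolarCauchy

variable {X : Type*} [NormedAddCommGroup X] [NormedSpace ℂ X]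

/-- `f(z) dz/dr` at `z = r e^{iθ}`. -/
noncomputable def radialForm (f : ℂ → X) (θ r : ℝ) : X :=
  Complex.exp (θ * Complex.I) • f (r * Complex.exp (θ * Complex.I))

/-- `f(z) dz/dθ` at `z = r e^{iθ}`. -/
noncomputable def angularForm (f : ℂ → X) (r θ : ℝ) : X :=
  (Complex.I * (r * Complex.exp (θ * Complex.I))) • f (r * Complex.exp (θ * Complex.I))

theorem norm_radialForm (f : ℂ → X) (θ r : ℝ) :
    ‖radialForm f θ r‖ = ‖f (r * Complex.exp (θ * Complex.I))‖ := by
  rw [radialForm, norm_smul, Complex.norm_exp_ofReal_mul_I, one_mul]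

theorem norm_angularForm (f : ℂ → X) {r : ℝ} (hr : 0 ≤ r) (θ : ℝ) :
    ‖angularForm f r θ‖ = r * ‖f (r * Complex.exp (θ * Complex.I))‖ := by
  rw [angularForm, norm_smul, norm_mul, norm_mul, Complex.norm_exp_ofReal_mul_I, Complex.norm_I,
    Complex.norm_real, Real.norm_of_nonneg hr, one_mul, mul_one]

/-- Differentiability at the points `r e^{iθ}` with `0 < r` and `α ≤ θ ≤ β`. -/
def SectorDifferentiable (f : ℂ → X) (α β : ℝ) : Prop :=
  ∀ r : ℝ, 0 < r → ∀ θ ∈ Icc α β, DifferentiableAt ℂ f (r * Complex.exp (θ * Complex.I))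

theorem SectorDifferentiable.mono {f : ℂ → X} {α β α' β' : ℝ} (h : SectorDifferentiable f α β)
    (hα : α ≤ α') (hβ : β' ≤ β) : SectorDifferentiable f α' β' :=
  fun r hr θ hθ => h r hr θ ⟨hα.trans hθ.1, hθ.2.trans hβ⟩

theorem SectorDifferentiable.continuousOn_radialForm {f : ℂ → X} {α β θ : ℝ}
    (h : SectorDifferentiable f α β) (hθ : θ ∈ Icc α β) :
    ContinuousOn (radialForm f θ) (Ioi 0) := by
  intro r hr
  have h1 : ContinuousAt (fun r : ℝ => f (r * Complex.exp (θ * Complex.I))) r :=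
    ContinuousAt.comp (f := fun r : ℝ => (r * Complex.exp (θ * Complex.I) : ℂ)) (g := f)
      (h r hr θ hθ).continuousAt (by fun_prop)
  exact (h1.const_smul _).continuousWithinAt

theorem SectorDifferentiable.continuousOn_angularForm {f : ℂ → X} {α β r : ℝ}
    (h : SectorDifferentiable f α β) (hr : 0 < r) :
    ContinuousOn (angularForm f r) (Icc α β) := by
  intro θ hθ
  have h1 : ContinuousAt (fun θ : ℝ => f (r * Complex.exp (θ * Complex.I))) θ :=
    ContinuousAt.comp (f := fun θ : ℝ => (r * Complex.exp (θ * Complex.I) : ℂ)) (g := f)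
      (h r hr θ hθ).continuousAt (by fun_prop)
  exact (ContinuousAt.smul (by fun_prop) h1).continuousWithinAt

/-- Cauchy's theorem on the boundary of a polar rectangle. -/
theorem integral_boundary_polar_rect [CompleteSpace X] {f : ℂ → X} {a b α β : ℝ} (ha : 0 < a)
    (hab : a ≤ b) (hαβ : α ≤ β) (hf : SectorDifferentiable f α β) :
    (∫ r in a..b, radialForm f α r) - (∫ r in a..b, radialForm f β r)
      + (∫ θ in α..β, angularForm f b θ) - ∫ θ in α..β, angularForm f a θ = 0 := by
  have hb : 0 < b := ha.trans_le hab
  -- Under z = e^w the polar rectangle is the image of a genuine rectangle and f(z) dz becomes F(w)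
  -- dw. No branch of the logarithm of z is needed.
  set F : ℂ → X := fun w => Complex.exp w • f (Complex.exp w) with hF
  have hexp : ∀ x θ : ℝ, Complex.exp (x + θ * Complex.I)
      = (Real.exp x : ℝ) * Complex.exp (θ * Complex.I) := by
    intro x θ; rw [Complex.exp_add, Complex.ofReal_exp]
  have hrect := Complex.integral_boundary_rect_eq_zero_of_differentiableOn F
    ⟨Real.log a, α⟩ ⟨Real.log b, β⟩ (by
      rintro ⟨x, θ⟩ hw
      simp only [Complex.mem_reProdIm, uIcc_of_le hαβ] at hw
      have h1 : (⟨x, θ⟩ : ℂ) = x + θ * Complex.I := by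
        apply Complex.ext <;> simp
      have h2 : DifferentiableAt ℂ f (Complex.exp ⟨x, θ⟩) := by
        rw [h1, hexp]; exact hf _ (Real.exp_pos x) θ hw.2
      have h3 : DifferentiableAt ℂ F ⟨x, θ⟩ :=
        Complex.differentiableAt_exp.smul (h2.comp _ Complex.differentiableAt_exp)
      exact h3.differentiableWithinAt)
  simp only at hrect
  have hray : ∀ θ ∈ Icc α β, ∫ x in Real.log a..Real.log b, F (x + θ * Complex.I)
      = ∫ r in a..b, radialForm f θ r := by
    intro θ hθ
    have h := intervalIntegral.integral_deriv_smul_comp''' (f := Real.exp) (f' := Real.exp)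
      (g := radialForm f θ) (a := Real.log a) (b := Real.log b)
      Real.continuous_exp.continuousOn
      (fun x _ => (Real.hasDerivAt_exp x).hasDerivWithinAt)
      ((hf.continuousOn_radialForm hθ).mono (by
        rintro _ ⟨x, -, rfl⟩; exact Real.exp_pos x))
      (by
        apply ContinuousOn.integrableOn_compact
        · exact isCompact_uIcc.image Real.continuous_exp
        · exact (hf.continuousOn_radialForm hθ).mono (by
            rintro _ ⟨x, -, rfl⟩; exact Real.exp_pos x))
      (by
        apply ContinuousOn.integrableOn_compact isCompact_uIcc
        apply Real.continuous_exp.continuousOn.smul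
        exact (hf.continuousOn_radialForm hθ).comp Real.continuous_exp.continuousOn
          (fun x _ => Real.exp_pos x))
    rw [Real.exp_log ha, Real.exp_log hb] at h
    rw [← h]
    refine intervalIntegral.integral_congr fun x _ => ?_
    simp only [hF, hexp, radialForm, Function.comp]
    rw [mul_smul]; rfl
  have harc : ∀ r : ℝ, 0 < r → Complex.I • ∫ θ in α..β, F (Real.log r + θ * Complex.I)
      = ∫ θ in α..β, angularForm f r θ := by
    intro r hr
    rw [← intervalIntegral.integral_smul]
    refine intervalIntegral.integral_congr fun θ _ => ?_
    simp only [hF, hexp, angularForm, Real.exp_log hr, mul_smul]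
  rw [hray α ⟨le_rfl, hαβ⟩, hray β ⟨hαβ, le_rfl⟩, harc a ha, harc b hb] at hrect
  exact hrect

/-- The arc integrals of `f` of radius `r` vanish in the limit when `r ‖f‖` does so uniformly. -/
theorem tendsto_integral_angularForm_zero {f : ℂ → X} {α β : ℝ} (hαβ : α ≤ β) {l : Filter ℝ}
    {g : ℝ → ℝ} (hl : ∀ᶠ r in l, 0 < r)
    (hbd : ∀ᶠ r : ℝ in l, ∀ θ ∈ Icc α β, ‖f (r * Complex.exp (θ * Complex.I))‖ ≤ g r)
    (hg : Tendsto (fun r => r * g r) l (𝓝 0)) :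
    Tendsto (fun r => ∫ θ in α..β, angularForm f r θ) l (𝓝 0) := by
  have h2 : Tendsto (fun r => r * g r * |β - α|) l (𝓝 0) := by simpa using hg.mul_const |β - α|
  refine squeeze_zero_norm' ?_ h2
  filter_upwards [hl, hbd] with r hr h
  refine intervalIntegral.norm_integral_le_of_norm_le_const fun θ hθ => ?_
  rw [uIoc_of_le hαβ] at hθ
  rw [norm_angularForm f hr.le]
  exact mul_le_mul_of_nonneg_left (h θ ⟨hθ.1.le, hθ.2⟩) hr.le

/-- Cauchy's theorem on the part `|z| ≥ a` of a sector. -/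
theorem integral_boundary_outer_sector [CompleteSpace X] {f : ℂ → X} {a α β : ℝ} {g : ℝ → ℝ}
    (ha : 0 < a) (hαβ : α ≤ β) (hf : SectorDifferentiable f α β)
    (hbd : ∀ r : ℝ, a ≤ r → ∀ θ ∈ Icc α β, ‖f (r * Complex.exp (θ * Complex.I))‖ ≤ g r)
    (hg : Tendsto (fun r => r * g r) atTop (𝓝 0))
    (hα : IntegrableOn (radialForm f α) (Ioi a)) (hβ : IntegrableOn (radialForm f β) (Ioi a)) :
    (∫ r in Ioi a, radialForm f α r) - (∫ r in Ioi a, radialForm f β r)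
      = ∫ θ in α..β, angularForm f a θ := by
  have h1 := ((intervalIntegral_tendsto_integral_Ioi a hα tendsto_id).sub
    (intervalIntegral_tendsto_integral_Ioi a hβ tendsto_id)).add
    (tendsto_integral_angularForm_zero hαβ (eventually_gt_atTop 0)
      ((eventually_ge_atTop a).mono hbd) hg)
  rw [add_zero] at h1
  refine tendsto_nhds_unique h1 (tendsto_const_nhds.congr' ?_)
  filter_upwards [eventually_ge_atTop a] with b hb
  exact (sub_eq_zero.mp (integral_boundary_polar_rect ha hb hαβ hf)).symm

/-- Cauchy's theorem on the part `|z| ≤ b` of a sector, for a function bounded near the vertex. -/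
theorem integral_boundary_inner_sector [CompleteSpace X] {f : ℂ → X} {b C α β : ℝ}
    (hb : 0 < b) (hαβ : α ≤ β) (hf : SectorDifferentiable f α β)
    (hbd : ∀ r : ℝ, 0 < r → r ≤ b → ∀ θ ∈ Icc α β, ‖f (r * Complex.exp (θ * Complex.I))‖ ≤ C)
    (hα : IntegrableOn (radialForm f α) (Ioi 0)) (hβ : IntegrableOn (radialForm f β) (Ioi 0)) :
    (∫ r in (0 : ℝ)..b, radialForm f α r) - (∫ r in (0 : ℝ)..b, radialForm f β r)
      + (∫ θ in α..β, angularForm f b θ) = 0 := by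
  have hlim : ∀ θ, IntegrableOn (radialForm f θ) (Ioi 0) →
      Tendsto (fun a => ∫ r in a..b, radialForm f θ r) (𝓝[>] 0)
        (𝓝 (∫ r in (0 : ℝ)..b, radialForm f θ r)) := by
    intro θ hθ
    have hi : IntegrableOn (radialForm f θ) (uIcc 0 b) := by
      rw [uIcc_of_le hb.le, integrableOn_Icc_iff_integrableOn_Ioc]
      exact hθ.mono_set Ioc_subset_Ioi_self
    have h := intervalIntegral.continuousOn_primitive_interval_left hi 0 left_mem_uIcc
    refine h.tendsto.mono_left ?_
    rw [uIcc_of_le hb.le, nhdsWithin_le_iff]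
    exact Icc_mem_nhdsGT hb
  -- Let the inner radius tend to 0: the inner arc is O(a) because f is bounded near the vertex.
  have h1 := (((hlim α hα).sub (hlim β hβ)).add_const (∫ θ in α..β, angularForm f b θ)).sub
    (tendsto_integral_angularForm_zero (f := f) (g := fun _ => C) hαβ (l := 𝓝[>] 0)
      self_mem_nhdsWithin
      (by filter_upwards [Ioc_mem_nhdsGT hb] with r hr using hbd r hr.1 hr.2)
      (by
        have : Tendsto (fun r : ℝ => r * C) (𝓝 0) (𝓝 (0 * C)) := tendsto_id.mul_const C
        rw [zero_mul] at this
        exact this.mono_left nhdsWithin_le_nhds))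
  rw [sub_zero] at h1
  refine tendsto_nhds_unique h1 (tendsto_const_nhds.congr' ?_)
  filter_upwards [Ioc_mem_nhdsGT hb] with a ha
  exact (integral_boundary_polar_rect ha.1 ha.2 hαβ hf).symm

end PolarCauchy

/-! ### The resolvent on the sector. -/

section Resolvent

variable {E : Type*} [NormedAddCommGroup E] [NormedSpace ℂ E]

/-- Resolvent equation and resolvent bound on the sector `Σ_δ`. -/
structure IsSectorialResolvent (R : ℂ → E →L[ℂ] E) (δ K : ℝ) : Prop where
  angle_pos : 0 < δ
  angle_lt : δ < Real.pi / 2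
  sub_eq : ∀ z ∈ sectorSet δ, ∀ w ∈ sectorSet δ, R z - R w = (w - z) • (R z * R w)
  bound : ∀ z ∈ sectorSet δ, ‖z‖ * ‖R z‖ ≤ K

theorem LinearPMap.resolvent_smul_sub [CompleteSpace E] {A : E →ₗ.[ℂ] E} (hA : A.IsClosed) {z : ℂ}
    (hz : z ∈ A.resolventSet) (x : A.domain) : A.resolvent z (z • (x : E) - A x) = x := by
  obtain ⟨x', hx', h⟩ := A.smulIdSub_resolvent hA z hz (z • (x : E) - A x)
  rw [← hx', hz.1 (show A.smulIdSub z x' = A.smulIdSub z x from h)]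

theorem LinearPMap.resolvent_sub_resolvent [CompleteSpace E] {A : E →ₗ.[ℂ] E} (hA : A.IsClosed)
    {z w : ℂ} (hz : z ∈ A.resolventSet) (hw : w ∈ A.resolventSet) :
    A.resolvent z - A.resolvent w = (w - z) • (A.resolvent z * A.resolvent w) := by
  ext y
  obtain ⟨x, hx, h⟩ := A.smulIdSub_resolvent hA w hw y
  have h1 := A.resolvent_smul_sub hA hz x
  have h2 : z • (x : E) - A x = y + (z - w) • (x : E) := by
    rw [← h, sub_smul]; abel
  rw [h2, _root_.map_add, _root_.map_smul] at h1
  change A.resolvent z y - A.resolvent w y = (w - z) • A.resolvent z (A.resolvent w y)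
  rw [← hx, ← neg_sub z w, neg_smul, eq_sub_of_add_eq h1]
  abel

theorem mem_sectorSet {δ r θ : ℝ} (hδ : δ < Real.pi / 2) (hr : 0 ≤ r)
    (hθ : |θ| < Real.pi / 2 + δ) : (r * Complex.exp (θ * Complex.I) : ℂ) ∈ sectorSet δ := by
  rcases hr.eq_or_lt with rfl | hr
  · right; simp
  · left
    refine ⟨mul_ne_zero (by exact_mod_cast hr.ne') (Complex.exp_ne_zero _), ?_⟩
    rw [abs_lt] at hθ
    rw [Complex.exp_mul_I, Complex.arg_mul_cos_add_sin_mul_I hr ⟨by linarith, by linarith⟩, abs_lt]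
    exact hθ

/-- As δ < π/2, the sector avoids the negative axis, so `arg` is continuous at its nonzero points.
The vertex must be excluded, since the sector is not a neighbourhood of 0. -/
theorem sectorSet_mem_nhds {δ : ℝ} (hδ : δ < Real.pi / 2) {z : ℂ} (hz : z ∈ sectorSet δ)
    (hz0 : z ≠ 0) : sectorSet δ ∈ 𝓝 z := by
  have hz' : |z.arg| < Real.pi / 2 + δ := (hz.resolve_right hz0).2
  have h1 : z ∈ Complex.slitPlane := by
    rw [Complex.mem_slitPlane_iff_arg]
    refine ⟨fun h => ?_, hz0⟩
    rw [h, abs_of_pos Real.pi_pos] at hz'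
    linarith
  have h2 : ∀ᶠ w in 𝓝 z, |w.arg| < Real.pi / 2 + δ :=
    (Complex.continuousAt_arg h1).abs.eventually (gt_mem_nhds hz')
  filter_upwards [h2, eventually_ne_nhds hz0] with w hw hw0 using Or.inl ⟨hw0, hw⟩

namespace IsSectorialResolvent

variable {R : ℂ → E →L[ℂ] E} {δ K : ℝ}

theorem zero_mem : (0 : ℂ) ∈ sectorSet δ := Or.inr rfl

theorem commute (h : IsSectorialResolvent R δ K) {z w : ℂ} (hz : z ∈ sectorSet δ)
    (hw : w ∈ sectorSet δ) : R z * R w = R w * R z := by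
  rcases eq_or_ne z w with rfl | hzw
  · rfl
  · have h1 := h.sub_eq z hz w hw
    have h2 := h.sub_eq w hw z hz
    rw [← neg_sub, h2, ← neg_smul, neg_sub] at h1
    exact (smul_right_injective _ (sub_ne_zero.mpr hzw.symm) h1).symm

theorem smul_mul_zero (h : IsSectorialResolvent R δ K) {z : ℂ} (hz : z ∈ sectorSet δ) :
    z • (R z * R 0) = R 0 - R z := by
  have h1 := h.sub_eq z hz 0 zero_mem
  rw [← neg_sub, h1, zero_sub, neg_smul, neg_neg]

/-- In R(z) = R(0) - z R(z) R(0) the factor z R(z) has norm at most K. This replaces K/|z|, which is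
useless near the vertex. -/
theorem norm_le (h : IsSectorialResolvent R δ K) {z : ℂ} (hz : z ∈ sectorSet δ) :
    ‖R z‖ ≤ (1 + K) * ‖R 0‖ := by
  have h1 : R z = R 0 - z • (R z * R 0) := by rw [h.smul_mul_zero hz]; abel
  calc ‖R z‖ = ‖R 0 - z • (R z * R 0)‖ := by rw [← h1]
    _ ≤ ‖R 0‖ + ‖z • (R z * R 0)‖ := norm_sub_le _ _
    _ ≤ ‖R 0‖ + ‖z‖ * (‖R z‖ * ‖R 0‖) := by
        rw [norm_smul]; gcongr; exact norm_mul_le _ _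
    _ = ‖R 0‖ + (‖z‖ * ‖R z‖) * ‖R 0‖ := by ring
    _ ≤ ‖R 0‖ + K * ‖R 0‖ := by gcongr; exact h.bound z hz
    _ = _ := by ring

theorem continuousAt (h : IsSectorialResolvent R δ K) {z : ℂ} (hz : z ∈ sectorSet δ)
    (hz0 : z ≠ 0) : ContinuousAt R z := by
  have hlim : Tendsto (fun w => ‖w - z‖ * (((1 + K) * ‖R 0‖) * ((1 + K) * ‖R 0‖))) (𝓝 z) (𝓝 0) := by
    have : Continuous fun w => ‖w - z‖ * (((1 + K) * ‖R 0‖) * ((1 + K) * ‖R 0‖)) := by fun_prop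
    simpa using this.tendsto z
  rw [ContinuousAt, tendsto_iff_norm_sub_tendsto_zero]
  refine squeeze_zero' (Eventually.of_forall fun _ => norm_nonneg _) ?_ hlim
  filter_upwards [sectorSet_mem_nhds h.angle_lt hz hz0] with w hw
  rw [h.sub_eq w hw z hz, norm_smul, norm_sub_rev]
  gcongr
  exact (norm_mul_le _ _).trans
    (mul_le_mul (h.norm_le hw) (h.norm_le hz) (norm_nonneg _)
      ((norm_nonneg _).trans (h.norm_le hw)))

/-- By the resolvent equation the difference quotient is exactly -R(w)R(z), so continuity suffices.
-/
theorem differentiableAt (h : IsSectorialResolvent R δ K) {z : ℂ} (hz : z ∈ sectorSet δ)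
    (hz0 : z ≠ 0) : DifferentiableAt ℂ R z := by
  have h1 : HasDerivAt R (-(R z * R z)) z := by
    rw [hasDerivAt_iff_tendsto_slope]
    have h2 : Tendsto (fun w => -(R w * R z)) (𝓝[≠] z) (𝓝 (-(R z * R z))) :=
      ((h.continuousAt hz hz0).tendsto.mul_const (R z)).neg.mono_left nhdsWithin_le_nhds
    refine h2.congr' ?_
    filter_upwards [self_mem_nhdsWithin,
      nhdsWithin_le_nhds (sectorSet_mem_nhds h.angle_lt hz hz0)] with w hw hw'
    rw [slope_def_module, h.sub_eq w hw' z hz, smul_smul, ← neg_sub w z, mul_neg,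
      inv_mul_cancel₀ (sub_ne_zero.mpr hw), neg_smul, one_smul]
  exact h1.differentiableAt

end IsSectorialResolvent

theorem LinearPMap.isSectorialResolvent [CompleteSpace E] {A : E →ₗ.[ℂ] E} (hA : A.IsClosed)
    {δ K : ℝ} (hδ : δ ∈ Ioo 0 (Real.pi / 2)) (hρ : sectorSet δ ⊆ A.resolventSet) (hK : 0 ≤ K)
    (hR : ∀ z ∈ sectorSet δ \ {0}, ‖A.resolvent z‖ ≤ K / ‖z‖) :
    IsSectorialResolvent A.resolvent δ K where
  angle_pos := hδ.1
  angle_lt := hδ.2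
  sub_eq _ hz _ hw := A.resolvent_sub_resolvent hA (hρ hz) (hρ hw)
  bound z hz := by
    rcases eq_or_ne z 0 with rfl | hz0
    · simpa using hK
    · have := hR z ⟨hz, hz0⟩
      rwa [le_div_iff₀' (norm_pos_iff.mpr hz0)] at this

/-- `R(0;A) = -A⁻¹`, in terms of graphs. -/
theorem LinearPMap.mem_graph_iff_resolvent_zero [CompleteSpace E] {A : E →ₗ.[ℂ] E}
    (hA : A.IsClosed) (h0 : (0 : ℂ) ∈ A.resolventSet) (x y : E) :
    (x, y) ∈ A.graph ↔ A.resolvent 0 y = -x := by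
  constructor
  · intro h
    obtain ⟨x', hx', hy⟩ := (A.mem_graph_iff).mp h
    have := A.resolvent_smul_sub hA h0 x'
    simp only at hx' hy
    rw [zero_smul, zero_sub, _root_.map_neg, hy, hx'] at this
    rw [← this, neg_neg]
  · intro h
    obtain ⟨x', hx', hy⟩ := A.smulIdSub_resolvent hA 0 h0 y
    rw [zero_smul, zero_sub] at hy
    refine (A.mem_graph_iff).mpr ⟨-x', ?_, ?_⟩
    · simp [hx', h]
    · simp [LinearPMap.map_neg, hy]

end Resolvent

/-! ### Rays, keyhole contours and two model integrals. -/

section Contour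

variable {X : Type*} [NormedAddCommGroup X] [NormedSpace ℂ X]

/-- The integral of `f` along the part `|z| ≥ a` of the rays of directions `-ν` and `ν`, joined by
the arc of radius `a` about `0`. -/
noncomputable def keyholeIntegral (f : ℂ → X) (ν a : ℝ) : X :=
  (∫ r in Ioi a, radialForm f ν r) - (∫ r in Ioi a, radialForm f (-ν) r)
    + ∫ θ in (-ν)..ν, angularForm f a θ

theorem SectorDifferentiable.integrableOn_radialForm {f : ℂ → X} {α β θ a κ C : ℝ}
    (h : SectorDifferentiable f α β) (hθ : θ ∈ Icc α β) (ha : 0 ≤ a) (hκ : 0 < κ)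
    (hbd : ∀ r : ℝ, a < r → ‖f (r * Complex.exp (θ * Complex.I))‖ ≤ C * Real.exp (-κ * r)) :
    IntegrableOn (radialForm f θ) (Ioi a) := by
  refine Integrable.mono' ((integrableOn_exp_mul_Ioi (neg_neg_of_pos hκ) a).const_mul C) ?_ ?_
  · exact ((h.continuousOn_radialForm hθ).mono (Ioi_subset_Ioi ha)).aestronglyMeasurable
      measurableSet_Ioi
  · filter_upwards [self_mem_ae_restrict measurableSet_Ioi] with r hr
    rw [norm_radialForm]
    exact hbd r hr

theorem tendsto_mul_exp_neg_mul {κ : ℝ} (hκ : 0 < κ) (C : ℝ) :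
    Tendsto (fun r : ℝ => r * (C * Real.exp (-κ * r))) atTop (𝓝 0) := by
  have h := ((Real.tendsto_pow_mul_exp_neg_atTop_nhds_zero 1).comp
    (tendsto_id.const_mul_atTop hκ)).const_mul (C / κ)
  rw [mul_zero] at h
  refine h.congr fun r => ?_
  simp only [Function.comp, id, pow_one, neg_mul]
  field_simp

/-- A ray may be turned inside a sector in which the integrand decays exponentially. -/
theorem integral_radialForm_eq [CompleteSpace X] {f : ℂ → X} {α β κ C : ℝ} (hκ : 0 < κ)
    (hC : 0 ≤ C) (hαβ : α ≤ β) (hf : SectorDifferentiable f α β)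
    (hbd : ∀ r : ℝ, 0 < r → ∀ θ ∈ Icc α β,
      ‖f (r * Complex.exp (θ * Complex.I))‖ ≤ C * Real.exp (-κ * r)) :
    ∫ r in Ioi (0 : ℝ), radialForm f α r = ∫ r in Ioi (0 : ℝ), radialForm f β r := by
  have hα : α ∈ Icc α β := ⟨le_rfl, hαβ⟩
  have hβ : β ∈ Icc α β := ⟨hαβ, le_rfl⟩
  have hiα := hf.integrableOn_radialForm hα le_rfl hκ fun r hr => hbd r hr α hα
  have hiβ := hf.integrableOn_radialForm hβ le_rfl hκ fun r hr => hbd r hr β hβ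
  have hsub : Ioi (1 : ℝ) ⊆ Ioi 0 := Ioi_subset_Ioi zero_le_one
  -- Cut at radius 1, an arbitrary choice: decay handles the outside, boundedness the inside, and
  -- the shared arc cancels.
  have h1 := integral_boundary_outer_sector one_pos hαβ hf
    (fun r hr θ hθ => hbd r (one_pos.trans_le hr) θ hθ) (tendsto_mul_exp_neg_mul hκ C)
    (hiα.mono_set hsub) (hiβ.mono_set hsub)
  have h2 := integral_boundary_inner_sector (C := C) one_pos hαβ hf
    (fun r hr _ θ hθ => (hbd r hr θ hθ).trans <| mul_le_of_le_one_right hC <| by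
      rw [Real.exp_le_one_iff]; nlinarith) hiα hiβ
  rw [← intervalIntegral.integral_interval_add_Ioi hiα (hiα.mono_set hsub),
    ← intervalIntegral.integral_interval_add_Ioi hiβ (hiβ.mono_set hsub), ← sub_eq_zero]
  rw [← h1] at h2
  rw [← h2]
  abel

/-- The arc from -ν to ν and the two segments to the vertex bound a sector on which f is
holomorphic, so they may be exchanged. -/
theorem keyholeIntegral_eq [CompleteSpace X] {f : ℂ → X} {ν b C : ℝ} (hb : 0 < b) (hν : 0 ≤ ν)
    (hf : SectorDifferentiable f (-ν) ν)
    (hbd : ∀ r : ℝ, 0 < r → r ≤ b → ∀ θ ∈ Icc (-ν) ν,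
      ‖f (r * Complex.exp (θ * Complex.I))‖ ≤ C)
    (hi : IntegrableOn (radialForm f ν) (Ioi 0))
    (hi' : IntegrableOn (radialForm f (-ν)) (Ioi 0)) :
    keyholeIntegral f ν b =
      (∫ r in Ioi (0 : ℝ), radialForm f ν r) - ∫ r in Ioi (0 : ℝ), radialForm f (-ν) r := by
  have hsub : Ioi b ⊆ Ioi 0 := Ioi_subset_Ioi hb.le
  have h := integral_boundary_inner_sector hb (neg_le_self hν) hf hbd hi' hi
  rw [← intervalIntegral.integral_interval_add_Ioi hi (hi.mono_set hsub),
    ← intervalIntegral.integral_interval_add_Ioi hi' (hi'.mono_set hsub), keyholeIntegral,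
    ← sub_eq_zero, ← h]
  abel

theorem integral_Ioi_exp_neg_mul {κ : ℝ} (hκ : 0 < κ) (a : ℝ) :
    ∫ r in Ioi a, Real.exp (-κ * r) = Real.exp (-κ * a) / κ := by
  rw [integral_exp_mul_Ioi (neg_neg_of_pos hκ), neg_div_neg_eq]

theorem norm_integral_radialForm_le {f : ℂ → X} {θ a κ C : ℝ} (hκ : 0 < κ)
    (hbd : ∀ r : ℝ, a < r → ‖f (r * Complex.exp (θ * Complex.I))‖ ≤ C * Real.exp (-κ * r)) :
    ‖∫ r in Ioi a, radialForm f θ r‖ ≤ C * (Real.exp (-κ * a) / κ) := by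
  rw [← integral_Ioi_exp_neg_mul hκ, ← integral_const_mul]
  refine norm_integral_le_of_norm_le
    ((integrableOn_exp_mul_Ioi (neg_neg_of_pos hκ) a).const_mul C) ?_
  filter_upwards [self_mem_ae_restrict measurableSet_Ioi] with r hr
  rw [norm_radialForm]
  exact hbd r hr

theorem re_polar (r θ : ℝ) : (r * Complex.exp (θ * Complex.I)).re = r * Real.cos θ := by
  rw [Complex.re_ofReal_mul, Complex.exp_ofReal_mul_I_re]

theorem norm_polar {r : ℝ} (hr : 0 ≤ r) (θ : ℝ) : ‖(r * Complex.exp (θ * Complex.I) : ℂ)‖ = r := by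
  rw [norm_mul, Complex.norm_exp_ofReal_mul_I, mul_one, Complex.norm_real, Real.norm_of_nonneg hr]

theorem norm_exp_polar (r θ t : ℝ) :
    ‖Complex.exp ((r * Complex.exp (θ * Complex.I)) * t)‖ = Real.exp (r * Real.cos θ * t) := by
  rw [Complex.norm_exp, Complex.re_mul_ofReal, re_polar]

/-- A bound for the keyhole integral at radius `1 / t` that is uniform in `t`. -/
theorem norm_keyholeIntegral_le {f : ℂ → X} {ν t D : ℝ} (ht : 0 < t) (hν : 0 ≤ ν)
    (hcos : Real.cos ν < 0) (hD : 0 ≤ D)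
    (hbd : ∀ r : ℝ, t⁻¹ ≤ r → ∀ θ ∈ Icc (-ν) ν,
      ‖f (r * Complex.exp (θ * Complex.I))‖ ≤ D * t * Real.exp (r * Real.cos θ * t)) :
    ‖keyholeIntegral f ν t⁻¹‖ ≤ D * (2 / (-Real.cos ν) + 2 * ν * Real.exp 1) := by
  have hκ : 0 < -Real.cos ν * t := mul_pos (neg_pos.mpr hcos) ht
  have hray : ∀ θ ∈ Icc (-ν) ν, Real.cos θ = Real.cos ν →
      ‖∫ r in Ioi t⁻¹, radialForm f θ r‖ ≤ D * (1 / (-Real.cos ν)) := by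
    intro θ hθ hc
    refine (norm_integral_radialForm_le (C := D * t) hκ fun r hr => ?_).trans ?_
    · refine (hbd r (le_of_lt hr) θ hθ).trans (le_of_eq ?_)
      rw [hc]; ring_nf
    · have h1 : Real.exp (-(-Real.cos ν * t) * t⁻¹) ≤ 1 := by
        rw [Real.exp_le_one_iff, neg_mul, neg_nonpos]
        positivity
      calc D * t * (Real.exp (-(-Real.cos ν * t) * t⁻¹) / (-Real.cos ν * t))
          ≤ D * t * (1 / (-Real.cos ν * t)) := by gcongr
        _ = D * (1 / (-Real.cos ν)) := by
            have := hcos.ne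
            field_simp
  -- The radius 1/t cancels the factor t of the bound, as the decay length of order 1/t did on the
  -- rays.
  have harc : ‖∫ θ in (-ν)..ν, angularForm f t⁻¹ θ‖ ≤ D * Real.exp 1 * |ν - -ν| := by
    refine intervalIntegral.norm_integral_le_of_norm_le_const fun θ hθ => ?_
    rw [uIoc_of_le (neg_le_self hν)] at hθ
    rw [norm_angularForm f (inv_nonneg.mpr ht.le)]
    calc t⁻¹ * ‖f ((t⁻¹ : ℝ) * Complex.exp (θ * Complex.I))‖
        ≤ t⁻¹ * (D * t * Real.exp (t⁻¹ * Real.cos θ * t)) := by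
          gcongr; exact hbd _ le_rfl θ ⟨hθ.1.le, hθ.2⟩
      _ = D * Real.exp (Real.cos θ) := by
          rw [mul_right_comm t⁻¹, inv_mul_cancel₀ ht.ne', one_mul]
          field_simp
      _ ≤ D * Real.exp 1 := by gcongr; exact Real.cos_le_one θ
  rw [sub_neg_eq_add, abs_of_nonneg (add_nonneg hν hν)] at harc
  have h1 := hray ν ⟨neg_le_self hν, le_rfl⟩ rfl
  have h2 := hray (-ν) ⟨le_rfl, neg_le_self hν⟩ (Real.cos_neg ν)
  calc ‖keyholeIntegral f ν t⁻¹‖ ≤ D * (1 / (-Real.cos ν)) + D * (1 / (-Real.cos ν))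
        + D * Real.exp 1 * (ν + ν) :=
        (norm_add_le _ _).trans (add_le_add ((norm_sub_le _ _).trans (add_le_add h1 h2)) harc)
    _ = _ := by ring

theorem cos_le_of_mem_Icc {ν θ : ℝ} (hν : Real.pi / 2 < ν) (hθ : θ ∈ Icc ν Real.pi) :
    Real.cos θ ≤ Real.cos ν :=
  Real.cos_le_cos_of_nonneg_of_le_pi (by linarith [Real.pi_pos]) hθ.2 hθ.1

/-- `∫ e^{tz} / z dz = 2πi` along the keyhole contour. -/
theorem keyholeIntegral_exp_div {ν t a : ℝ} (ht : 0 < t) (ha : 0 < a)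
    (hν : ν ∈ Ioo (Real.pi / 2) Real.pi) :
    keyholeIntegral (fun z : ℂ => Complex.exp (z * t) * z⁻¹) ν a = 2 * Real.pi * Complex.I := by
  set f : ℂ → ℂ := fun z : ℂ => Complex.exp (z * t) * z⁻¹ with hf_def
  have hf : ∀ α β, SectorDifferentiable f α β := by
    intro α β r hr θ _
    have : (r * Complex.exp (θ * Complex.I) : ℂ) ≠ 0 :=
      mul_ne_zero (by exact_mod_cast hr.ne') (Complex.exp_ne_zero _)
    exact (by fun_prop : DifferentiableAt ℂ (fun z : ℂ => Complex.exp (z * t)) _).mul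
      (differentiableAt_inv this)
  have hcos : Real.cos ν < 0 :=
    Real.cos_neg_of_pi_div_two_lt_of_lt hν.1 (by linarith [hν.2, Real.pi_pos])
  have hκ : 0 < -Real.cos ν * t := mul_pos (neg_pos.mpr hcos) ht
  have hbd : ∀ r : ℝ, a ≤ r → ∀ θ : ℝ, Real.cos θ ≤ Real.cos ν →
      ‖f (r * Complex.exp (θ * Complex.I))‖ ≤ a⁻¹ * Real.exp (-(-Real.cos ν * t) * r) := by
    intro r hr θ hθ
    have hr0 := ha.trans_le hr
    rw [hf_def, norm_mul, norm_inv, norm_exp_polar, norm_polar hr0.le, mul_comm]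
    have h1 : r * Real.cos θ * t ≤ -(-Real.cos ν * t) * r := by
      have : r * t * Real.cos θ ≤ r * t * Real.cos ν := by gcongr
      linarith
    gcongr
  have hint : ∀ θ : ℝ, Real.cos θ ≤ Real.cos ν → IntegrableOn (radialForm f θ) (Ioi a) :=
    fun θ hθ => (hf θ θ).integrableOn_radialForm ⟨le_rfl, le_rfl⟩ ha.le hκ
      fun r hr => hbd r (le_of_lt hr) θ hθ
  have hup : ∀ θ ∈ Icc ν Real.pi, Real.cos θ ≤ Real.cos ν := fun θ hθ => cos_le_of_mem_Icc hν.1 hθ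
  have hdown : ∀ θ ∈ Icc (-Real.pi) (-ν), Real.cos θ ≤ Real.cos ν := by
    intro θ hθ
    rw [← Real.cos_neg θ]
    exact hup _ ⟨by linarith [hθ.2], by linarith [hθ.1]⟩
  -- Both rays are turned to the negative axis, where they coincide and cancel. What remains is a
  -- full circle, evaluated by Cauchy's formula.
  have h1 := integral_boundary_outer_sector ha hν.2.le (hf ν Real.pi)
    (fun r hr θ hθ => hbd r hr θ (hup θ hθ)) (tendsto_mul_exp_neg_mul hκ _)
    (hint _ (hup _ ⟨le_rfl, hν.2.le⟩)) (hint _ (hup _ ⟨hν.2.le, le_rfl⟩))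
  have h2 := integral_boundary_outer_sector ha (neg_le_neg hν.2.le) (hf (-Real.pi) (-ν))
    (fun r hr θ hθ => hbd r hr θ (hdown θ hθ)) (tendsto_mul_exp_neg_mul hκ _)
    (hint _ (hdown _ ⟨le_rfl, neg_le_neg hν.2.le⟩)) (hint _ (hdown _ ⟨neg_le_neg hν.2.le, le_rfl⟩))
  have h3 : radialForm f Real.pi = radialForm f (-Real.pi) := by
    ext r
    simp [radialForm, Complex.exp_neg, Complex.exp_pi_mul_I]
  have harc : ∀ α β, IntervalIntegrable (angularForm f a) volume α β := fun α β =>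
    ((hf (min α β) (max α β)).continuousOn_angularForm ha).intervalIntegrable
  have h4 : ∫ θ in (-Real.pi)..Real.pi, angularForm f a θ = 2 * Real.pi * Complex.I := by
    have hcirc : ∮ z in C(0, a), (z - 0)⁻¹ • Complex.exp (z * t)
        = (2 * Real.pi * Complex.I : ℂ) • Complex.exp (0 * t) :=
      (by fun_prop : Differentiable ℂ fun z : ℂ => Complex.exp (z * t)).diffContOnCl
        |>.circleIntegral_sub_inv_smul (Metric.mem_ball_self ha)
    -- Periodicity moves the range from [-π, π] to the [0, 2π] of `circleIntegral`.
    have hper : Function.Periodic (angularForm f a) (2 * Real.pi) := by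
      intro θ
      have : Complex.exp (((θ + 2 * Real.pi : ℝ) : ℂ) * Complex.I)
          = Complex.exp (θ * Complex.I) := by
        rw [← Complex.exp_periodic (θ * Complex.I)]
        congr 1; push_cast; ring
      simp only [angularForm, this]
    have hshift := hper.intervalIntegral_add_eq (-Real.pi) 0
    rw [show -Real.pi + 2 * Real.pi = Real.pi by ring, zero_add] at hshift
    rw [hshift]
    simp only [zero_mul, Complex.exp_zero, smul_eq_mul, mul_one] at hcirc
    rw [← hcirc, circleIntegral]
    refine intervalIntegral.integral_congr fun θ _ => ?_
    simp only [angularForm, deriv_circleMap, circleMap, smul_eq_mul, hf_def, sub_zero, zero_add]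
    ring
  rw [← intervalIntegral.integral_add_adjacent_intervals (harc _ (-ν)) (harc _ _),
    ← intervalIntegral.integral_add_adjacent_intervals (harc (-ν) ν) (harc _ _), ← h1, ← h2, h3]
    at h4
  rw [keyholeIntegral, ← h4]
  ring

/-- The integral of `e^{zt}` along a ray in the left half-plane is `-1/t`, whatever the ray. -/
theorem integral_radialForm_exp {θ t : ℝ} (ht : 0 < t) (hθ : Real.cos θ < 0) :
    ∫ r in Ioi (0 : ℝ), radialForm (fun z : ℂ => Complex.exp (z * t)) θ r = -(t : ℂ)⁻¹ := by
  have ht' : (t : ℂ) ≠ 0 := by exact_mod_cast ht.ne'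
  have hre : (Complex.exp (θ * Complex.I) * t).re < 0 := by
    rw [Complex.re_mul_ofReal, Complex.exp_ofReal_mul_I_re]
    exact mul_neg_of_neg_of_pos hθ ht
  have h := integral_exp_mul_complex_Ioi hre 0
  have h2 : ∀ r : ℝ, radialForm (fun z : ℂ => Complex.exp (z * t)) θ r
      = Complex.exp (θ * Complex.I) * Complex.exp (Complex.exp (θ * Complex.I) * t * r) := by
    intro r
    rw [radialForm, smul_eq_mul]
    congr 2; ring
  simp only [h2]
  rw [integral_const_mul, h]
  have := Complex.exp_ne_zero (θ * Complex.I)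
  simp only [Complex.ofReal_zero, mul_zero, Complex.exp_zero]
  field_simp

end Contour

/-! ### The contour integral: convergence, independence of the angle, uniform bound. -/

section Semigroup

variable {E : Type*} [NormedAddCommGroup E] [NormedSpace ℂ E]

/-- `e^{zt} R(z)`. -/
noncomputable def expSMul (R : ℂ → E →L[ℂ] E) (t : ℝ) (z : ℂ) : E →L[ℂ] E :=
  Complex.exp (z * t) • R z

/-- `(2πi)⁻¹ ∫ e^{zt} R(z) dz` along `Γ_ν`. -/
noncomputable def dunfordIntegral (R : ℂ → E →L[ℂ] E) (ν t : ℝ) : E →L[ℂ] E :=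
  (1 / (2 * (Real.pi : ℂ) * Complex.I)) •
    ((∫ r in Ioi (0 : ℝ), radialForm (expSMul R t) ν r)
      - ∫ r in Ioi (0 : ℝ), radialForm (expSMul R t) (-ν) r)

namespace IsSectorialResolvent

variable {R : ℂ → E →L[ℂ] E} {δ K : ℝ}

theorem ne_zero_polar {r : ℝ} (hr : 0 < r) (θ : ℝ) : (r * Complex.exp (θ * Complex.I) : ℂ) ≠ 0 :=
  mul_ne_zero (by exact_mod_cast hr.ne') (Complex.exp_ne_zero _)

theorem cos_neg (h : IsSectorialResolvent R δ K) {ν : ℝ}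
    (hν : ν ∈ Ioo (Real.pi / 2) (Real.pi / 2 + δ)) : Real.cos ν < 0 :=
  Real.cos_neg_of_pi_div_two_lt_of_lt hν.1 (by linarith [hν.2, h.angle_lt, Real.pi_pos])

theorem lt_pi (h : IsSectorialResolvent R δ K) {ν : ℝ}
    (hν : ν ∈ Ioo (Real.pi / 2) (Real.pi / 2 + δ)) : ν < Real.pi := by
  linarith [hν.2, h.angle_lt]

theorem polar_mem (h : IsSectorialResolvent R δ K) {ν r θ : ℝ}
    (hν : ν ∈ Ioo (Real.pi / 2) (Real.pi / 2 + δ)) (hr : 0 ≤ r) (hθ : θ ∈ Icc (-ν) ν) :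
    (r * Complex.exp (θ * Complex.I) : ℂ) ∈ sectorSet δ :=
  mem_sectorSet h.angle_lt hr ((abs_le.mpr hθ).trans_lt hν.2)

theorem bound_nonneg (h : IsSectorialResolvent R δ K) : 0 ≤ K := by
  simpa using h.bound 0 zero_mem

theorem const_nonneg (h : IsSectorialResolvent R δ K) : 0 ≤ (1 + K) * ‖R 0‖ :=
  mul_nonneg (by linarith [h.bound_nonneg]) (norm_nonneg _)

theorem sectorDifferentiable (h : IsSectorialResolvent R δ K) {ν : ℝ}
    (hν : ν ∈ Ioo (Real.pi / 2) (Real.pi / 2 + δ)) (t : ℝ) :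
    SectorDifferentiable (expSMul R t) (-ν) ν := fun r hr θ hθ =>
  (by fun_prop : DifferentiableAt ℂ (fun z : ℂ => Complex.exp (z * t)) _).smul
    (h.differentiableAt (h.polar_mem hν hr.le hθ) (ne_zero_polar hr θ))

theorem norm_expSMul_le (h : IsSectorialResolvent R δ K) {ν r θ : ℝ} (t : ℝ)
    (hν : ν ∈ Ioo (Real.pi / 2) (Real.pi / 2 + δ)) (hr : 0 ≤ r) (hθ : θ ∈ Icc (-ν) ν) :
    ‖expSMul R t (r * Complex.exp (θ * Complex.I))‖
      ≤ (1 + K) * ‖R 0‖ * Real.exp (r * Real.cos θ * t) := by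
  rw [expSMul, norm_smul, norm_exp_polar, mul_comm]
  gcongr
  exact h.norm_le (h.polar_mem hν hr hθ)

/-- The rate depends only on c and ε, so one bound serves a range of angles and a range of times: it
is used for turning rays, for uniformity in t ≥ ε and for domination near a given t. -/
theorem norm_expSMul_le_of_cos_le (h : IsSectorialResolvent R δ K) {ν r θ ε t c : ℝ}
    (hν : ν ∈ Ioo (Real.pi / 2) (Real.pi / 2 + δ)) (hr : 0 ≤ r) (hθ : θ ∈ Icc (-ν) ν)
    (hε : 0 ≤ ε) (hεt : ε ≤ t) (hcθ : Real.cos θ ≤ c) (hc : c ≤ 0) :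
    ‖expSMul R t (r * Complex.exp (θ * Complex.I))‖
      ≤ (1 + K) * ‖R 0‖ * Real.exp (-(-c * ε) * r) := by
  refine (h.norm_expSMul_le t hν hr hθ).trans ?_
  have h1 : r * Real.cos θ * t ≤ -(-c * ε) * r := by
    have h2 : r * (t * Real.cos θ) ≤ r * (ε * c) := by
      refine mul_le_mul_of_nonneg_left ?_ hr
      calc t * Real.cos θ ≤ t * c := mul_le_mul_of_nonneg_left hcθ (hε.trans hεt)
        _ ≤ ε * c := mul_le_mul_of_nonpos_right hεt hc
    linarith
  have := h.const_nonneg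
  gcongr

theorem cos_of_mem_pair {ν θ : ℝ} (hθ : θ ∈ ({ν, -ν} : Set ℝ)) : Real.cos θ = Real.cos ν := by
  rcases hθ with rfl | rfl
  · rfl
  · exact Real.cos_neg ν

theorem mem_Icc_of_mem_pair {ν θ : ℝ} (hν : Real.pi / 2 < ν) (hθ : θ ∈ ({ν, -ν} : Set ℝ)) :
    θ ∈ Icc (-ν) ν := by
  have : 0 < ν := by linarith [Real.pi_pos]
  rcases hθ with rfl | rfl <;> constructor <;> linarith

theorem integrableOn (h : IsSectorialResolvent R δ K) {ν θ t : ℝ}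
    (hν : ν ∈ Ioo (Real.pi / 2) (Real.pi / 2 + δ)) (hθ : θ ∈ ({ν, -ν} : Set ℝ)) (ht : 0 < t) :
    IntegrableOn (radialForm (expSMul R t) θ) (Ioi 0) :=
  (h.sectorDifferentiable hν t).integrableOn_radialForm (mem_Icc_of_mem_pair hν.1 hθ) le_rfl
    (mul_pos (neg_pos.mpr (h.cos_neg hν)) ht)
    fun _ hr => h.norm_expSMul_le_of_cos_le hν (le_of_lt hr) (mem_Icc_of_mem_pair hν.1 hθ) ht.le
      le_rfl (cos_of_mem_pair hθ).le (h.cos_neg hν).le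

/-- The tail beyond N is at most a constant times e^{Nε cos ν}, with no dependence on t. -/
theorem tendstoUniformlyOn (h : IsSectorialResolvent R δ K) {ν θ ε : ℝ}
    (hν : ν ∈ Ioo (Real.pi / 2) (Real.pi / 2 + δ)) (hθ : θ ∈ ({ν, -ν} : Set ℝ)) (hε : 0 < ε) :
    TendstoUniformlyOn (fun N t : ℝ => ∫ r in (0 : ℝ)..N, radialForm (expSMul R t) θ r)
      (fun t : ℝ => ∫ r in Ioi (0 : ℝ), radialForm (expSMul R t) θ r) atTop (Ici ε) := by
  have hκ : 0 < -Real.cos ν * ε := mul_pos (neg_pos.mpr (h.cos_neg hν)) hε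
  have hlim : Tendsto (fun N : ℝ => (1 + K) * ‖R 0‖ *
      (Real.exp (-(-Real.cos ν * ε) * N) / (-Real.cos ν * ε))) atTop (𝓝 0) := by
    have h1 : Tendsto (fun N : ℝ => Real.exp (-(-Real.cos ν * ε) * N)) atTop (𝓝 0) :=
      Real.tendsto_exp_atBot.comp (tendsto_id.const_mul_atTop_of_neg (neg_neg_of_pos hκ))
    simpa using (h1.div_const (-Real.cos ν * ε)).const_mul ((1 + K) * ‖R 0‖)
  rw [Metric.tendstoUniformlyOn_iff]
  intro η hη
  filter_upwards [hlim.eventually (gt_mem_nhds hη), eventually_ge_atTop 0] with N hN hN0 t ht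
  have ht0 : 0 < t := hε.trans_le ht
  have hi := h.integrableOn hν hθ ht0
  rw [dist_eq_norm, ← intervalIntegral.integral_interval_add_Ioi hi
    (hi.mono_set (Ioi_subset_Ioi hN0)), add_sub_cancel_left]
  exact (norm_integral_radialForm_le hκ fun r hr =>
    h.norm_expSMul_le_of_cos_le hν (hN0.trans (le_of_lt hr)) (mem_Icc_of_mem_pair hν.1 hθ) hε.le ht
      (cos_of_mem_pair hθ).le (h.cos_neg hν).le).trans_lt hN

/-- Each ray is turned separately. The cosine decreases towards π, so the rate at the smaller angle
ν holds throughout. -/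
theorem dunfordIntegral_eq_of_le [CompleteSpace E] (h : IsSectorialResolvent R δ K) {ν ν' t : ℝ}
    (hν : ν ∈ Ioo (Real.pi / 2) (Real.pi / 2 + δ)) (hν' : ν' ∈ Ioo (Real.pi / 2) (Real.pi / 2 + δ))
    (hνν' : ν ≤ ν') (ht : 0 < t) : dunfordIntegral R ν t = dunfordIntegral R ν' t := by
  have hν0 : 0 < ν := by linarith [Real.pi_pos, hν.1]
  have hκ : 0 < -Real.cos ν * t := mul_pos (neg_pos.mpr (h.cos_neg hν)) ht
  have hcos : ∀ θ ∈ Icc ν ν', Real.cos θ ≤ Real.cos ν := fun θ hθ =>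
    cos_le_of_mem_Icc hν.1 ⟨hθ.1, hθ.2.trans (h.lt_pi hν').le⟩
  have h1 := integral_radialForm_eq hκ h.const_nonneg hνν'
    ((h.sectorDifferentiable hν' t).mono (by linarith) le_rfl)
    fun r hr θ hθ => h.norm_expSMul_le_of_cos_le hν' hr.le ⟨by linarith [hθ.1], hθ.2⟩ ht.le le_rfl
      (hcos θ hθ) (h.cos_neg hν).le
  have h2 := integral_radialForm_eq hκ h.const_nonneg (neg_le_neg hνν')
    ((h.sectorDifferentiable hν' t).mono le_rfl (by linarith))
    fun r hr θ hθ => h.norm_expSMul_le_of_cos_le hν' hr.le ⟨hθ.1, by linarith [hθ.2]⟩ ht.le le_rfl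
      (Real.cos_neg θ ▸ hcos (-θ) ⟨by linarith [hθ.2], by linarith [hθ.1]⟩) (h.cos_neg hν).le
  rw [dunfordIntegral, dunfordIntegral, h1, h2]

theorem dunfordIntegral_eq [CompleteSpace E] (h : IsSectorialResolvent R δ K) {ν ν' t : ℝ}
    (hν : ν ∈ Ioo (Real.pi / 2) (Real.pi / 2 + δ)) (hν' : ν' ∈ Ioo (Real.pi / 2) (Real.pi / 2 + δ))
    (ht : 0 < t) : dunfordIntegral R ν t = dunfordIntegral R ν' t := by
  rcases le_total ν ν' with hle | hle
  · exact h.dunfordIntegral_eq_of_le hν hν' hle ht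
  · exact (h.dunfordIntegral_eq_of_le hν' hν hle ht).symm

theorem norm_expSMul_le_of_inv_le (h : IsSectorialResolvent R δ K) {ν r θ t : ℝ} (ht : 0 < t)
    (hν : ν ∈ Ioo (Real.pi / 2) (Real.pi / 2 + δ)) (hr : t⁻¹ ≤ r) (hθ : θ ∈ Icc (-ν) ν) :
    ‖expSMul R t (r * Complex.exp (θ * Complex.I))‖ ≤ K * t * Real.exp (r * Real.cos θ * t) := by
  have hr0 : 0 < r := (inv_pos.mpr ht).trans_le hr
  have h1 := h.bound _ (h.polar_mem hν hr0.le hθ)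
  rw [norm_polar hr0.le] at h1
  rw [expSMul, norm_smul, norm_exp_polar, mul_comm]
  gcongr
  have h2 : ‖R (r * Complex.exp (θ * Complex.I))‖ ≤ K / r := (le_div_iff₀' hr0).mpr h1
  refine h2.trans ?_
  rw [div_eq_mul_inv]
  exact mul_le_mul_of_nonneg_left (inv_le_of_inv_le₀ ht hr) h.bound_nonneg

theorem keyholeIntegral_expSMul [CompleteSpace E] (h : IsSectorialResolvent R δ K) {ν t : ℝ}
    (hν : ν ∈ Ioo (Real.pi / 2) (Real.pi / 2 + δ)) (ht : 0 < t) :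
    (1 / (2 * (Real.pi : ℂ) * Complex.I)) • keyholeIntegral (expSMul R t) ν t⁻¹
      = dunfordIntegral R ν t := by
  have hν0 : 0 < ν := by linarith [Real.pi_pos, hν.1]
  have ht' := inv_pos.mpr ht
  rw [dunfordIntegral, keyholeIntegral_eq (C := (1 + K) * ‖R 0‖ * Real.exp 1) ht' hν0.le
    (h.sectorDifferentiable hν t) _ (h.integrableOn hν (by simp) ht)
    (h.integrableOn hν (by simp) ht)]
  intro r hr hrt θ hθ
  refine (h.norm_expSMul_le t hν hr.le hθ).trans ?_
  have h1 : r * Real.cos θ * t ≤ 1 := by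
    have h2 : r * t ≤ 1 := by
      calc r * t ≤ t⁻¹ * t := by gcongr
        _ = 1 := inv_mul_cancel₀ ht.ne'
    have h3 : r * t * Real.cos θ ≤ r * t * 1 :=
      mul_le_mul_of_nonneg_left (Real.cos_le_one θ) (by positivity)
    linarith
  have := h.const_nonneg
  gcongr

/-- Estimating along Γ_ν with the bounded resolvent would only give O(1/t). On the keyhole of radius
1/t the bound K/r ≤ Kt makes the estimate free of t. -/
theorem norm_dunfordIntegral_le [CompleteSpace E] (h : IsSectorialResolvent R δ K) {ν t : ℝ}
    (hν : ν ∈ Ioo (Real.pi / 2) (Real.pi / 2 + δ)) (ht : 0 < t) :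
    ‖dunfordIntegral R ν t‖ ≤ ‖1 / (2 * (Real.pi : ℂ) * Complex.I)‖ *
      (K * (2 / (-Real.cos ν) + 2 * ν * Real.exp 1)) := by
  rw [← h.keyholeIntegral_expSMul hν ht, norm_smul]
  refine mul_le_mul_of_nonneg_left ?_ (norm_nonneg _)
  exact norm_keyholeIntegral_le ht (by linarith [Real.pi_pos, hν.1]) (h.cos_neg hν) h.bound_nonneg
    fun r hr θ hθ => h.norm_expSMul_le_of_inv_le ht hν hr hθ

theorem commute_integral [CompleteSpace E] (h : IsSectorialResolvent R δ K) {ν θ t : ℝ}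
    (hν : ν ∈ Ioo (Real.pi / 2) (Real.pi / 2 + δ)) (hθ : θ ∈ ({ν, -ν} : Set ℝ)) (ht : 0 < t) :
    Commute (∫ r in Ioi (0 : ℝ), radialForm (expSMul R t) θ r) (R 0) := by
  rw [Commute, SemiconjBy, ← integral_mul_const_of_integrable (h.integrableOn hν hθ ht),
    ← integral_const_mul_of_integrable (h.integrableOn hν hθ ht)]
  refine setIntegral_congr_fun measurableSet_Ioi fun r hr => ?_
  simp only [radialForm, expSMul, smul_mul_assoc, mul_smul_comm]
  rw [h.commute (h.polar_mem hν (le_of_lt hr) (mem_Icc_of_mem_pair hν.1 hθ)) zero_mem]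

theorem commute_dunfordIntegral [CompleteSpace E] (h : IsSectorialResolvent R δ K) {ν t : ℝ}
    (hν : ν ∈ Ioo (Real.pi / 2) (Real.pi / 2 + δ)) (ht : 0 < t) :
    Commute (dunfordIntegral R ν t) (R 0) :=
  ((h.commute_integral hν (by simp) ht).sub_left
    (h.commute_integral hν (by simp) ht)).smul_left _

theorem keyholeIntegral_sub {X : Type*} [NormedAddCommGroup X] [NormedSpace ℂ X] {f g : ℂ → X}
    {ν a : ℝ}
    (hf : ∀ θ ∈ ({ν, -ν} : Set ℝ), IntegrableOn (radialForm f θ) (Ioi a))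
    (hg : ∀ θ ∈ ({ν, -ν} : Set ℝ), IntegrableOn (radialForm g θ) (Ioi a))
    (hf' : IntervalIntegrable (angularForm f a) volume (-ν) ν)
    (hg' : IntervalIntegrable (angularForm g a) volume (-ν) ν) :
    keyholeIntegral (fun z => f z - g z) ν a = keyholeIntegral f ν a - keyholeIntegral g ν a := by
  have h1 : ∀ θ r : ℝ, radialForm (fun z => f z - g z) θ r = radialForm f θ r - radialForm g θ r :=
    fun θ r => smul_sub _ _ _
  have h2 : ∀ r θ : ℝ, angularForm (fun z => f z - g z) r θ = angularForm f r θ - angularForm g r θ :=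
    fun r θ => smul_sub _ _ _
  simp only [keyholeIntegral, h1, h2]
  rw [integral_sub (hf ν (by simp)) (hg ν (by simp)),
    integral_sub (hf (-ν) (by simp)) (hg (-ν) (by simp)), intervalIntegral.integral_sub hf' hg']
  abel

end IsSectorialResolvent
end Semigroup

/-! ### T(t)R(0): behaviour at t = 0 and derivative. -/

section Semigroup

variable {E : Type*} [NormedAddCommGroup E] [NormedSpace ℂ E]

namespace IsSectorialResolvent

variable {R : ℂ → E →L[ℂ] E} {δ K : ℝ}

theorem keyholeIntegral_mul {f : ℂ → E →L[ℂ] E} {ν a : ℝ} (hν : 0 ≤ ν)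
    (hf : ∀ θ ∈ ({ν, -ν} : Set ℝ), IntegrableOn (radialForm f θ) (Ioi a))
    (hf' : IntervalIntegrable (angularForm f a) volume (-ν) ν) (L : E →L[ℂ] E) :
    keyholeIntegral (fun z => f z * L) ν a = keyholeIntegral f ν a * L := by
  have h1 : ∀ θ r : ℝ, radialForm (fun z => f z * L) θ r = radialForm f θ r * L :=
    fun θ r => (smul_mul_assoc _ _ _).symm
  have h2 : ∀ r θ : ℝ, angularForm (fun z => f z * L) r θ = angularForm f r θ * L :=
    fun r θ => (smul_mul_assoc _ _ _).symm
  simp only [keyholeIntegral, h1, h2]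
  rw [integral_mul_const_of_integrable (hf ν (by simp)),
    integral_mul_const_of_integrable (hf (-ν) (by simp)),
    intervalIntegral.integral_of_le (neg_le_self hν),
    intervalIntegral.integral_of_le (neg_le_self hν),
    integral_mul_const_of_integrable (by
      rwa [intervalIntegrable_iff_integrableOn_Ioc_of_le (neg_le_self hν)] at hf'),
    add_mul, sub_mul]

theorem keyholeIntegral_smul_const [CompleteSpace E] (φ : ℂ → ℂ) (ν a : ℝ) (L : E →L[ℂ] E) :
    keyholeIntegral (fun z => φ z • L) ν a = keyholeIntegral φ ν a • L := by
  have h1 : ∀ θ r : ℝ, radialForm (fun z => φ z • L) θ r = radialForm φ θ r • L :=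
    fun θ r => by simp only [radialForm, smul_assoc]
  have h2 : ∀ r θ : ℝ, angularForm (fun z => φ z • L) r θ = angularForm φ r θ • L :=
    fun r θ => by simp only [angularForm, smul_assoc]
  simp only [keyholeIntegral, h1, h2]
  rw [integral_smul_const, integral_smul_const, intervalIntegral.integral_smul_const, add_smul,
    sub_smul]

/-- This is z R(z) R(0) = R(0) - R(z) divided by z. The extra z⁻¹ on the right, at most t in norm on
the keyhole, is the source of the rate O(t). -/
theorem inv_smul_zero_sub (h : IsSectorialResolvent R δ K) {z : ℂ} (hz : z ∈ sectorSet δ)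
    (hz0 : z ≠ 0) (t : ℝ) :
    (Complex.exp (z * t) * z⁻¹) • R 0 - expSMul R t z * R 0 = z⁻¹ • expSMul R t z := by
  have h1 : R z * R 0 = z⁻¹ • (R 0 - R z) := by
    rw [← h.smul_mul_zero hz, inv_smul_smul₀ hz0]
  rw [expSMul, smul_mul_assoc, h1, smul_sub, smul_sub, smul_smul, sub_sub_cancel, smul_smul,
    smul_smul, mul_comm]

/-- `‖T(t) R(0) - R(0)‖ = O(t)`. -/
theorem norm_zero_sub_dunfordIntegral_mul_le [CompleteSpace E] (h : IsSectorialResolvent R δ K)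
    {ν t : ℝ} (hν : ν ∈ Ioo (Real.pi / 2) (Real.pi / 2 + δ)) (ht : 0 < t) :
    ‖R 0 - dunfordIntegral R ν t * R 0‖ ≤ ‖1 / (2 * (Real.pi : ℂ) * Complex.I)‖ *
      (K * t * (2 / (-Real.cos ν) + 2 * ν * Real.exp 1)) := by
  have hν0 : 0 < ν := by linarith [Real.pi_pos, hν.1]
  have ht' : 0 < t⁻¹ := inv_pos.mpr ht
  have hsub : Ioi t⁻¹ ⊆ Ioi 0 := Ioi_subset_Ioi ht'.le
  have hκ : 0 < -Real.cos ν * t := mul_pos (neg_pos.mpr (h.cos_neg hν)) ht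
  set φ : ℂ → ℂ := fun z => Complex.exp (z * t) * z⁻¹ with hφ
  have hφd : SectorDifferentiable (fun z => φ z • R 0) (-ν) ν := fun r hr θ _ =>
    ((by fun_prop : DifferentiableAt ℂ (fun z : ℂ => Complex.exp (z * t)) _).mul
      (differentiableAt_inv (ne_zero_polar hr θ))).smul_const _
  have hRi : ∀ θ ∈ ({ν, -ν} : Set ℝ), IntegrableOn (radialForm (expSMul R t) θ) (Ioi t⁻¹) :=
    fun θ hθ => (h.integrableOn hν hθ ht).mono_set hsub
  have hRa : IntervalIntegrable (angularForm (expSMul R t) t⁻¹) volume (-ν) ν :=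
    ((h.sectorDifferentiable hν t).continuousOn_angularForm ht').intervalIntegrable_of_Icc
      (neg_le_self hν0.le)
  have hφi : ∀ θ ∈ ({ν, -ν} : Set ℝ),
      IntegrableOn (radialForm (fun z => φ z • R 0) θ) (Ioi t⁻¹) := fun θ hθ =>
    hφd.integrableOn_radialForm (C := t * ‖R 0‖) (mem_Icc_of_mem_pair hν.1 hθ) ht'.le hκ
      fun r hr => by
        have hr0 : 0 < r := ht'.trans hr
        rw [norm_smul, norm_mul, norm_exp_polar, norm_inv, norm_polar hr0.le,
          cos_of_mem_pair hθ, show r * Real.cos ν * t = -(-Real.cos ν * t) * r by ring]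
        have : r⁻¹ ≤ t := inv_le_of_inv_le₀ ht (le_of_lt hr)
        calc _ ≤ Real.exp (-(-Real.cos ν * t) * r) * t * ‖R 0‖ := by gcongr
          _ = _ := by ring
  have hφa : IntervalIntegrable (angularForm (fun z => φ z • R 0) t⁻¹) volume (-ν) ν :=
    (hφd.continuousOn_angularForm ht').intervalIntegrable_of_Icc (neg_le_self hν0.le)
  have hmi : ∀ θ ∈ ({ν, -ν} : Set ℝ),
      IntegrableOn (radialForm (fun z => expSMul R t z * R 0) θ) (Ioi t⁻¹) := fun θ hθ =>
    ((hRi θ hθ).mul_const (R 0)).congr (ae_of_all _ fun r => smul_mul_assoc _ _ _)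
  have hma : IntervalIntegrable (angularForm (fun z => expSMul R t z * R 0) t⁻¹) volume (-ν) ν := by
    refine (hRa.mul_const (R 0)).congr fun θ _ => smul_mul_assoc _ _ _
  have key := keyholeIntegral_sub hφi hmi hφa hma
  rw [keyholeIntegral_smul_const, keyholeIntegral_mul hν0.le hRi hRa,
    keyholeIntegral_exp_div ht ht' ⟨hν.1, h.lt_pi hν⟩] at key
  have hpi : (2 * (Real.pi : ℂ) * Complex.I) ≠ 0 := Complex.two_pi_I_ne_zero
  have key2 : R 0 - dunfordIntegral R ν t * R 0 = (1 / (2 * (Real.pi : ℂ) * Complex.I)) •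
      keyholeIntegral (fun z => φ z • R 0 - expSMul R t z * R 0) ν t⁻¹ := by
    rw [key, smul_sub, smul_smul, one_div_mul_cancel hpi, one_smul,
      ← h.keyholeIntegral_expSMul hν ht, smul_mul_assoc]
  rw [key2, norm_smul]
  refine mul_le_mul_of_nonneg_left ?_ (norm_nonneg _)
  refine norm_keyholeIntegral_le ht hν0.le (h.cos_neg hν) (mul_nonneg h.bound_nonneg ht.le)
    fun r hr θ hθ => ?_
  have hr0 : 0 < r := ht'.trans_le hr
  rw [h.inv_smul_zero_sub (h.polar_mem hν hr0.le hθ) (ne_zero_polar hr0 θ), norm_smul, norm_inv,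
    norm_polar hr0.le]
  calc r⁻¹ * ‖expSMul R t (r * Complex.exp (θ * Complex.I))‖
      ≤ t * (K * t * Real.exp (r * Real.cos θ * t)) :=
        mul_le_mul (inv_le_of_inv_le₀ ht hr) (h.norm_expSMul_le_of_inv_le ht hν hr hθ)
          (norm_nonneg _) ht.le
    _ = _ := by ring

/-- The factor z brought down by differentiation is absorbed by R(0): z e^{zt} R(z) R(0) = e^{zt}
R(0) - e^{zt} R(z), and e^{zt} integrates to -1/t. -/
theorem hasDerivAt_integral_mul [CompleteSpace E] (h : IsSectorialResolvent R δ K) {ν θ t : ℝ}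
    (hν : ν ∈ Ioo (Real.pi / 2) (Real.pi / 2 + δ)) (hθ : θ ∈ ({ν, -ν} : Set ℝ)) (ht : 0 < t) :
    HasDerivAt (fun s : ℝ => (∫ r in Ioi (0 : ℝ), radialForm (expSMul R s) θ r) * R 0)
      (-(t : ℂ)⁻¹ • R 0 - ∫ r in Ioi (0 : ℝ), radialForm (expSMul R t) θ r) t := by
  have hθ' := mem_Icc_of_mem_pair hν.1 hθ
  have hcos : Real.cos θ < 0 := (cos_of_mem_pair hθ).trans_lt (h.cos_neg hν)
  have hκ : 0 < -Real.cos θ * (t / 2) := mul_pos (neg_pos.mpr hcos) (half_pos ht)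
  set F : ℝ → ℝ → E →L[ℂ] E := fun s r => radialForm (expSMul R s) θ r * R 0 with hF
  set F' : ℝ → ℝ → E →L[ℂ] E := fun s r =>
    radialForm (fun z : ℂ => Complex.exp (z * s)) θ r • R 0 - radialForm (expSMul R s) θ r with hF'
  have hFi : ∀ s : ℝ, 0 < s → IntegrableOn (F s) (Ioi 0) := fun s hs =>
    (h.integrableOn hν hθ hs).mul_const (R 0)
  have hed : SectorDifferentiable (fun z : ℂ => Complex.exp (z * t)) θ θ :=
    fun r _ θ _ => by fun_prop
  have hei : IntegrableOn (radialForm (fun z : ℂ => Complex.exp (z * t)) θ) (Ioi 0) :=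
    hed.integrableOn_radialForm (C := 1) (κ := -Real.cos θ * t) ⟨le_rfl, le_rfl⟩ le_rfl
      (mul_pos (neg_pos.mpr hcos) ht) fun r _ => by
        rw [norm_exp_polar, one_mul]
        exact le_of_eq (by ring_nf)
  -- For times s > t/2 the decay rate is at least that at t/2, which gives the dominating function.
  have hder := (hasDerivAt_integral_of_dominated_loc_of_deriv_le (𝕜 := ℝ)
    (μ := volume.restrict (Ioi (0 : ℝ))) (s := Ioi (t / 2)) (F := F) (F' := F') (x₀ := t)
    (bound := fun r => (‖R 0‖ + (1 + K) * ‖R 0‖) * Real.exp (-(-Real.cos θ * (t / 2)) * r))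
    (Ioi_mem_nhds (half_lt_self ht))
    ((eventually_gt_nhds ht).mono fun s hs => (hFi s hs).aestronglyMeasurable)
    (hFi t ht)
    ((hei.smul_const (R 0)).sub (h.integrableOn hν hθ ht)).aestronglyMeasurable
    (by
      filter_upwards [self_mem_ae_restrict measurableSet_Ioi] with r hr s hs
      have hr' : 0 < r := hr
      refine (norm_sub_le _ _).trans ?_
      rw [norm_smul, norm_radialForm, norm_radialForm, add_mul]
      refine add_le_add ?_ (h.norm_expSMul_le_of_cos_le hν hr'.le hθ' (half_pos ht).le
        (le_of_lt hs) le_rfl hcos.le)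
      rw [norm_exp_polar, mul_comm]
      refine mul_le_mul_of_nonneg_left ?_ (norm_nonneg _)
      rw [Real.exp_le_exp]
      have : r * (-Real.cos θ) * (t / 2) ≤ r * (-Real.cos θ) * s :=
        mul_le_mul_of_nonneg_left (le_of_lt hs) (mul_nonneg hr'.le (neg_pos.mpr hcos).le)
      linarith)
    ((integrableOn_exp_mul_Ioi (neg_neg_of_pos hκ) 0).const_mul _)
    (by
      filter_upwards [self_mem_ae_restrict measurableSet_Ioi] with r hr s _
      set z : ℂ := r * Complex.exp (θ * Complex.I) with hz
      have hzm : z ∈ sectorSet δ := h.polar_mem hν (le_of_lt hr) hθ'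
      have h1 : HasDerivAt (fun s : ℝ => Complex.exp (z * s)) (Complex.exp (z * s) * z) s := by
        have h2 : HasDerivAt (fun w : ℂ => Complex.exp (z * w)) (Complex.exp (z * s) * z) s := by
          simpa using ((hasDerivAt_id (s : ℂ)).const_mul z).cexp
        exact h2.comp_ofReal
      have h3 := (h1.const_mul (Complex.exp (θ * Complex.I))).smul_const (R z * R 0)
      have h4 : F' s r = (Complex.exp (θ * Complex.I) * (Complex.exp (z * s) * z)) •
          (R z * R 0) := by
        simp only [hF', radialForm, expSMul, ← hz]
        rw [mul_smul, mul_smul, h.smul_mul_zero hzm, smul_eq_mul, mul_smul, ← smul_sub, ← smul_sub]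
      rw [h4]
      refine h3.congr_of_eventuallyEq (Eventually.of_forall fun s => ?_)
      simp only [hF, radialForm, expSMul, ← hz]
      rw [smul_mul_assoc, smul_mul_assoc, smul_smul])).2
  have h5 : ∫ r in Ioi (0 : ℝ), F' t r
      = -(t : ℂ)⁻¹ • R 0 - ∫ r in Ioi (0 : ℝ), radialForm (expSMul R t) θ r := by
    rw [hF', integral_sub (hei.smul_const (R 0)) (h.integrableOn hν hθ ht), integral_smul_const,
      integral_radialForm_exp ht hcos]
  rw [h5] at hder
  refine hder.congr_of_eventuallyEq ?_
  filter_upwards [eventually_gt_nhds ht] with s hs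
  rw [hF, integral_mul_const_of_integrable (h.integrableOn hν hθ hs)]

/-- The terms -t⁻¹ R(0) are the same on both rays and cancel in the difference. -/
theorem hasDerivAt_dunfordIntegral_mul [CompleteSpace E] (h : IsSectorialResolvent R δ K)
    {ν t : ℝ} (hν : ν ∈ Ioo (Real.pi / 2) (Real.pi / 2 + δ)) (ht : 0 < t) :
    HasDerivAt (fun s : ℝ => dunfordIntegral R ν s * R 0) (-dunfordIntegral R ν t) t := by
  have h1 := ((h.hasDerivAt_integral_mul hν (by simp : ν ∈ ({ν, -ν} : Set ℝ)) ht).sub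
    (h.hasDerivAt_integral_mul hν (by simp : -ν ∈ ({ν, -ν} : Set ℝ)) ht)).const_smul
    (1 / (2 * (Real.pi : ℂ) * Complex.I))
  rw [sub_sub_sub_cancel_left] at h1
  rw [dunfordIntegral, ← smul_neg, neg_sub]
  refine h1.congr_of_eventuallyEq (Eventually.of_forall fun s => ?_)
  simp only [dunfordIntegral, smul_mul_assoc, sub_mul, Pi.sub_apply, Pi.smul_apply]

end IsSectorialResolvent
end Semigroup

/-! ### Semigroup law, strong continuity and generator. -/

section Generation

variable {E : Type*} [NormedAddCommGroup E] [NormedSpace ℂ E]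

/-- The semigroup generated by the operator with resolvent `R`, extended by `1` to `t < 0`. -/
noncomputable def dunfordSemigroup (R : ℂ → E →L[ℂ] E) (ν t : ℝ) : E →L[ℂ] E :=
  if 0 < t then dunfordIntegral R ν t else 1

theorem dunfordSemigroup_of_pos (R : ℂ → E →L[ℂ] E) (ν : ℝ) {t : ℝ} (ht : 0 < t) :
    dunfordSemigroup R ν t = dunfordIntegral R ν t := if_pos ht

theorem dunfordSemigroup_zero (R : ℂ → E →L[ℂ] E) (ν : ℝ) : dunfordSemigroup R ν 0 = 1 :=
  if_neg (lt_irrefl 0)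

namespace IsSectorialResolvent

variable {R : ℂ → E →L[ℂ] E} {δ K ν : ℝ}

theorem exists_norm_dunfordSemigroup_le [CompleteSpace E] (h : IsSectorialResolvent R δ K)
    (hν : ν ∈ Ioo (Real.pi / 2) (Real.pi / 2 + δ)) :
    ∃ M : ℝ, 1 < M ∧ ∀ t : ℝ, 0 ≤ t → ‖dunfordSemigroup R ν t‖ ≤ M := by
  -- The 2 ensures M > 1 and covers t = 0.
  refine ⟨max 2 (‖1 / (2 * (Real.pi : ℂ) * Complex.I)‖ *
    (K * (2 / (-Real.cos ν) + 2 * ν * Real.exp 1))), lt_max_of_lt_left one_lt_two, fun t ht => ?_⟩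
  rcases ht.eq_or_lt with rfl | ht
  · rw [dunfordSemigroup_zero]
    exact le_max_of_le_left ((ContinuousLinearMap.norm_id_le (𝕜 := ℂ) (E := E)).trans one_le_two)
  · rw [dunfordSemigroup_of_pos R ν ht]
    exact le_max_of_le_right (h.norm_dunfordIntegral_le hν ht)

theorem commute_dunfordSemigroup [CompleteSpace E] (h : IsSectorialResolvent R δ K)
    (hν : ν ∈ Ioo (Real.pi / 2) (Real.pi / 2 + δ)) {t : ℝ} (ht : 0 ≤ t) :
    Commute (dunfordSemigroup R ν t) (R 0) := by
  rcases ht.eq_or_lt with rfl | ht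
  · rw [dunfordSemigroup_zero]; exact Commute.one_left _
  · rw [dunfordSemigroup_of_pos R ν ht]; exact h.commute_dunfordIntegral hν ht

theorem hasDerivAt_dunfordSemigroup_mul [CompleteSpace E] (h : IsSectorialResolvent R δ K)
    (hν : ν ∈ Ioo (Real.pi / 2) (Real.pi / 2 + δ)) {t : ℝ} (ht : 0 < t) :
    HasDerivAt (fun s : ℝ => dunfordSemigroup R ν s * R 0) (-dunfordSemigroup R ν t) t := by
  rw [dunfordSemigroup_of_pos R ν ht]
  refine (h.hasDerivAt_dunfordIntegral_mul hν ht).congr_of_eventuallyEq ?_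
  filter_upwards [eventually_gt_nhds ht] with s hs
  rw [dunfordSemigroup_of_pos R ν hs]

theorem tendsto_dunfordSemigroup_mul [CompleteSpace E] (h : IsSectorialResolvent R δ K)
    (hν : ν ∈ Ioo (Real.pi / 2) (Real.pi / 2 + δ)) :
    Tendsto (fun s : ℝ => dunfordSemigroup R ν s * R 0) (𝓝[>] 0) (𝓝 (R 0)) := by
  set C : ℝ := 2 / (-Real.cos ν) + 2 * ν * Real.exp 1
  have hlim : Tendsto (fun t : ℝ => ‖1 / (2 * (Real.pi : ℂ) * Complex.I)‖ * (K * t * C))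
      (𝓝[>] 0) (𝓝 0) := by
    have hc : Continuous fun t : ℝ => ‖1 / (2 * (Real.pi : ℂ) * Complex.I)‖ * (K * t * C) := by
      fun_prop
    have := hc.tendsto 0
    simp only [mul_zero, zero_mul] at this
    exact this.mono_left nhdsWithin_le_nhds
  rw [tendsto_iff_norm_sub_tendsto_zero]
  refine squeeze_zero' (Eventually.of_forall fun _ => norm_nonneg _) ?_ hlim
  filter_upwards [self_mem_nhdsWithin] with t ht
  rw [norm_sub_rev, dunfordSemigroup_of_pos R ν ht]
  exact h.norm_zero_sub_dunfordIntegral_mul_le hν ht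

theorem continuousOn_dunfordSemigroup_mul [CompleteSpace E] (h : IsSectorialResolvent R δ K)
    (hν : ν ∈ Ioo (Real.pi / 2) (Real.pi / 2 + δ)) :
    ContinuousOn (fun s : ℝ => dunfordSemigroup R ν s * R 0) (Ici 0) := by
  intro t ht
  rcases (show (0 : ℝ) ≤ t from ht).eq_or_lt with rfl | ht
  · rw [← Ioi_insert, continuousWithinAt_insert_self, ContinuousWithinAt, dunfordSemigroup_zero,
      one_mul]
    exact h.tendsto_dunfordSemigroup_mul hν
  · exact (h.hasDerivAt_dunfordSemigroup_mul hν ht).continuousAt.continuousWithinAt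

/-- The product g(τ) = T(t+s-τ)R(0) T(τ)R(0) is constant on [s, t+s]; its endpoint values are the
two sides, each carrying R(0) twice. -/
theorem dunfordSemigroup_add [CompleteSpace E] (h : IsSectorialResolvent R δ K)
    (hinj : Function.Injective (R 0))
    (hν : ν ∈ Ioo (Real.pi / 2) (Real.pi / 2 + δ)) {t s : ℝ} (ht : 0 ≤ t) (hs : 0 ≤ s) :
    dunfordSemigroup R ν (t + s) = dunfordSemigroup R ν t * dunfordSemigroup R ν s := by
  rcases hs.eq_or_lt with rfl | hs
  · rw [add_zero, dunfordSemigroup_zero, mul_one]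
  set T := dunfordSemigroup R ν
  set g : ℝ → E →L[ℂ] E := fun τ => (T (t + s - τ) * R 0) * (T τ * R 0) with hg
  have hcont : ContinuousOn g (Icc s (t + s)) :=
    ((h.continuousOn_dunfordSemigroup_mul hν).comp (by fun_prop)
      fun τ hτ => sub_nonneg.mpr hτ.2).mul
      ((h.continuousOn_dunfordSemigroup_mul hν).mono fun τ hτ => hs.le.trans hτ.1)
  -- With s > 0 both factors are differentiable here. At τ = t + s the first one reaches time 0,
  -- where only continuity is known, and only continuity is needed.
  have hder : ∀ τ ∈ Ico s (t + s), HasDerivWithinAt g 0 (Ici τ) τ := by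
    intro τ hτ
    have hτ0 : 0 < τ := hs.trans_le hτ.1
    have hτ1 : 0 < t + s - τ := sub_pos.mpr hτ.2
    have h1 : HasDerivAt (fun τ : ℝ => T (t + s - τ) * R 0) (T (t + s - τ)) τ := by
      have := (h.hasDerivAt_dunfordSemigroup_mul hν hτ1).scomp τ
        ((hasDerivAt_id τ).const_sub (t + s))
      simpa [Function.comp_def] using this
    have h2 := h1.mul (h.hasDerivAt_dunfordSemigroup_mul hν hτ0)
    have h3 : T (t + s - τ) * (T τ * R 0) + T (t + s - τ) * R 0 * -T τ = 0 := by
      rw [(h.commute_dunfordSemigroup hν hτ0.le).eq, mul_neg, mul_assoc, add_neg_cancel]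
    rw [h3] at h2
    exact h2.hasDerivWithinAt
  have hconst := constant_of_has_deriv_right_zero hcont hder (t + s)
    ⟨le_add_of_nonneg_left ht, le_rfl⟩
  simp only [hg, sub_self, add_sub_cancel_right] at hconst
  -- Every R(0) is moved to the far left, to be cancelled there by injectivity.
  rw [show T 0 = 1 from dunfordSemigroup_zero R ν, one_mul,
    (h.commute_dunfordSemigroup hν (add_nonneg ht hs.le)).eq,
    (h.commute_dunfordSemigroup hν ht).eq, (h.commute_dunfordSemigroup hν hs.le).eq,
    mul_assoc (R 0) (T t), ← mul_assoc (T t) (R 0), (h.commute_dunfordSemigroup hν ht).eq,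
    mul_assoc (R 0) (T t)] at hconst
  ext x
  exact hinj (hinj (DFunLike.congr_fun hconst x))

theorem tendsto_dunfordSemigroup_apply [CompleteSpace E] (h : IsSectorialResolvent R δ K)
    (hdense : DenseRange (R 0)) (hν : ν ∈ Ioo (Real.pi / 2) (Real.pi / 2 + δ)) (x : E) :
    Tendsto (fun t : ℝ => dunfordSemigroup R ν t x) (𝓝[>] 0) (𝓝 x) := by
  obtain ⟨M, hM1, hM⟩ := h.exists_norm_dunfordSemigroup_le hν
  rw [Metric.tendsto_nhds]
  intro ε hε
  have hM0 : 0 < M + 2 := by linarith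
  obtain ⟨y, hy⟩ := hdense.exists_dist_lt x (div_pos hε hM0)
  have h1 : Tendsto (fun t : ℝ => dunfordSemigroup R ν t (R 0 y)) (𝓝[>] 0) (𝓝 (R 0 y)) :=
    ((ContinuousLinearMap.apply ℂ E y).continuous.tendsto (R 0)).comp
      (h.tendsto_dunfordSemigroup_mul hν)
  filter_upwards [Metric.tendsto_nhds.mp h1 _ (div_pos hε hM0), self_mem_nhdsWithin] with t ht ht0
  set T := dunfordSemigroup R ν t
  have h2 : dist (T x) (T (R 0 y)) ≤ M * dist x (R 0 y) := by
    rw [dist_eq_norm, dist_eq_norm, ← _root_.map_sub]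
    exact T.le_of_opNorm_le (hM t (le_of_lt ht0)) _
  calc dist (T x) x ≤ dist (T x) (T (R 0 y)) + dist (T (R 0 y)) (R 0 y) + dist (R 0 y) x :=
        dist_triangle4 _ _ _ _
    _ < M * (ε / (M + 2)) + ε / (M + 2) + ε / (M + 2) := by
        rw [dist_comm (R 0 y) x]
        have h3 : M * dist x (R 0 y) ≤ M * (ε / (M + 2)) := by gcongr
        linarith
    _ = ε := by field_simp; ring

/-- Here T(s)x = -T(s)R(0)y has derivative T(s)y for s > 0. Since T(s)x and T(s)y converge as s ↓ 0,
the one-sided derivative at 0 exists and is y. -/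
theorem tendsto_slope_dunfordSemigroup [CompleteSpace E] (h : IsSectorialResolvent R δ K)
    (hdense : DenseRange (R 0)) (hν : ν ∈ Ioo (Real.pi / 2) (Real.pi / 2 + δ)) {x y : E}
    (hxy : R 0 y = -x) :
    Tendsto (fun t : ℝ => ((t⁻¹ : ℝ) : ℂ) • (dunfordSemigroup R ν t x - x)) (𝓝[>] 0) (𝓝 y) := by
  set T := dunfordSemigroup R ν
  have hder : ∀ t : ℝ, 0 < t → HasDerivAt (fun s => T s x) (T t y) t := by
    intro t ht
    have h1 := (((ContinuousLinearMap.apply ℂ E y).restrictScalars ℝ).hasFDerivAt.comp_hasDerivAt t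
      (h.hasDerivAt_dunfordSemigroup_mul hν ht)).neg
    have h2 : (-((ContinuousLinearMap.apply ℂ E y).restrictScalars ℝ ∘ fun s => T s * R 0))
        = fun s => T s x := by
      ext s
      change -(T s (R 0 y)) = T s x
      rw [hxy, _root_.map_neg, neg_neg]
    have h3 : -((ContinuousLinearMap.apply ℂ E y).restrictScalars ℝ (-T t)) = T t y := by
      change -(-T t) y = T t y
      simp
    rw [← h2, ← h3]
    exact h1
  have hT0 : T 0 x = x := by rw [show T 0 = 1 from dunfordSemigroup_zero R ν]; rfl
  have h0 : HasDerivWithinAt (fun s => T s x) y (Ici 0) 0 := by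
    refine hasDerivWithinAt_Ici_of_tendsto_deriv (s := Ioi 0)
      (fun t ht => (hder t ht).differentiableAt.differentiableWithinAt) ?_ self_mem_nhdsWithin ?_
    · rw [ContinuousWithinAt, hT0]
      exact h.tendsto_dunfordSemigroup_apply hdense hν x
    · refine (h.tendsto_dunfordSemigroup_apply hdense hν y).congr' ?_
      filter_upwards [self_mem_nhdsWithin] with t ht using (hder t ht).deriv.symm
  have h1 := (hasDerivWithinAt_iff_tendsto_slope' self_notMem_Ioi).mp h0.Ioi_of_Ici
  refine h1.congr fun t => ?_
  rw [slope_def_module, hT0, sub_zero, Complex.coe_smul]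

end IsSectorialResolvent

theorem LinearPMap.rayIntegrand_eq (A : E →ₗ.[ℂ] E) (θ t r : ℝ) :
    A.rayIntegrand θ t r = radialForm (expSMul A.resolvent t) θ r := by
  have h1 : ((Real.cos θ : ℂ) + (Real.sin θ : ℂ) * Complex.I) = Complex.exp (θ * Complex.I) := by
    rw [Complex.exp_mul_I, Complex.ofReal_cos, Complex.ofReal_sin]
  have h2 : rayPoint θ r = r * Complex.exp (θ * Complex.I) := by rw [rayPoint, h1]
  rw [rayIntegrand, radialForm, expSMul, h1, h2, smul_smul, mul_comm]

end Generation

theorem mainTheorem10 {E : Type*} [NormedAddCommGroup E] [NormedSpace ℂ E] [CompleteSpace E]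
    (A : E →ₗ.[ℂ] E) (hA_closed : A.IsClosed) (hA_dense : Dense (A.domain : Set E))
    (δ : ℝ) (hδ : δ ∈ Ioo 0 (Real.pi / 2)) (hρ : sectorSet δ ⊆ A.resolventSet)
    (K : ℝ) (hK : 1 < K) (hR : ∀ z ∈ sectorSet δ \ {0}, ‖A.resolvent z‖ ≤ K / ‖z‖) :
    ∃ T : ℝ → E →L[ℂ] E,
      IsC0Semigroup T ∧ IsInfinitesimalGenerator A T ∧
      (∃ M : ℝ, 1 < M ∧ ∀ t : ℝ, 0 ≤ t → ‖T t‖ ≤ M) ∧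
      ∀ ν ∈ Ioo (Real.pi / 2) (Real.pi / 2 + δ),
        (∀ t : ℝ, 0 < t →
          IntegrableOn (A.rayIntegrand ν t) (Ioi 0) ∧
          IntegrableOn (A.rayIntegrand (-ν) t) (Ioi 0) ∧
          T t = (1 / (2 * (Real.pi : ℂ) * Complex.I)) • A.sectorContourIntegral ν t) ∧
        ∀ ε : ℝ, 0 < ε → ∀ θ ∈ ({ν, -ν} : Set ℝ),
          TendstoUniformlyOn
            (fun (N : ℝ) (t : ℝ) => ∫ r in (0 : ℝ)..N, A.rayIntegrand θ t r)
            (fun t : ℝ => ∫ r in Ioi (0 : ℝ), A.rayIntegrand θ t r)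
            atTop (Ici ε) := by
  have h := LinearPMap.isSectorialResolvent hA_closed hδ hρ (by linarith) hR
  have hray : ∀ θ t : ℝ, A.rayIntegrand θ t = radialForm (expSMul A.resolvent t) θ :=
    fun θ t => funext fun r => A.rayIntegrand_eq θ t r
  have hgraph := LinearPMap.mem_graph_iff_resolvent_zero hA_closed
    (hρ IsSectorialResolvent.zero_mem)
  have hinj : Function.Injective (A.resolvent 0) := by
    refine (injective_iff_map_eq_zero _).mpr fun y hy => ?_
    have h1 : ((0 : E), y) ∈ A.graph := (hgraph 0 y).mpr (by rw [hy, neg_zero])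
    exact A.graph_fst_eq_zero_snd h1 rfl
  have hdense : DenseRange (A.resolvent 0) := by
    refine hA_dense.mono fun x hx => ?_
    have h1 := (hgraph x (A ⟨x, hx⟩)).mp (A.mem_graph ⟨x, hx⟩)
    exact ⟨-A ⟨x, hx⟩, by rw [_root_.map_neg, h1, neg_neg]⟩
  -- T must be fixed before ν is given. Any admissible angle will do, since the integral does not
  -- depend on it.
  set μ : ℝ := Real.pi / 2 + δ / 2 with hμ_def
  have hμ : μ ∈ Ioo (Real.pi / 2) (Real.pi / 2 + δ) := by
    constructor <;> linarith [hδ.1]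
  refine ⟨dunfordSemigroup A.resolvent μ, ⟨dunfordSemigroup_zero _ _,
    fun t s ht hs => h.dunfordSemigroup_add hinj hμ ht hs,
    h.tendsto_dunfordSemigroup_apply hdense hμ⟩, fun x y => ?_,
    h.exists_norm_dunfordSemigroup_le hμ, fun ν hν => ⟨fun t ht => ⟨?_, ?_, ?_⟩, ?_⟩⟩
  · refine ⟨fun hxy => h.tendsto_slope_dunfordSemigroup hdense hμ ((hgraph x y).mp hxy),
      fun hlim => (hgraph x y).mpr ?_⟩
    -- R(0) commutes with T(t), so R(0) applied to the quotient of x is the quotient of R(0)x, which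
    -- lies in D(A) and has limit -x.
    have h1 := ((A.resolvent 0).continuous.tendsto y).comp hlim
    have h2 := h.tendsto_slope_dunfordSemigroup hdense hμ
      (x := A.resolvent 0 x) (y := -x) (by rw [_root_.map_neg])
    refine tendsto_nhds_unique h1 (h2.congr' ?_)
    filter_upwards [self_mem_nhdsWithin] with t ht
    have h3 := DFunLike.congr_fun (h.commute_dunfordSemigroup hμ (le_of_lt ht)).eq x
    change _ = A.resolvent 0 (_ • (_ - _))
    rw [_root_.map_smul, _root_.map_sub]
    exact congrArg (fun v => _ • (v - _)) h3
  · rw [hray]; exact h.integrableOn hν (by simp) ht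
  · rw [hray]; exact h.integrableOn hν (by simp) ht
  · rw [dunfordSemigroup_of_pos _ _ ht, h.dunfordIntegral_eq hμ hν ht, dunfordIntegral,
      LinearPMap.sectorContourIntegral, hray, hray]
  · intro ε hε θ hθ
    simp only [hray]
    exact h.tendstoUniformlyOn hν hθ hε
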